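/- Let $C$ be a Riemann surface, $n\ge 0$, $L$ a holomorphic line bundle on $C$, and let $E=J^{n-1}(L)\to C$ be the holomorphic vector bundle of rank $n$ whose fibre $E_p$ is the space of $(n-1)$-jets at $p$ of holomorphic sections of $L$, i.e. the space of sections holomorphic near $p$ modulo those vanishing at $p$ to order at least $n$ (a particular case is $C$ compact of genus $g>1$ and $L=K_C^{-\frac{n-1}{2}}$). Let $$\{0\}=F^0_p\subset F^1_p\subset\dots\subset F^{n}_p=E_p$$ be its complete filtration, in which $F^r_p$ is the space of jets of sections vanishing at $p$ to order at least $n-r$, so that $\dim F^r_p=r$. Let $\pi:X=Fl(E)\to C$ be the relative complete flag bundle, a complex manifold whose fibre $X_p$ over $p\in C$ is the manifold $Fl(E_p)$ of complete flags $W^\bullet:\{0\}=W^0\subset W^1\subset\dots\subset W^n=E_p$, $\dim W^j=j$. Let $X_0\subset X$ be the set of all flags $W^\bullet\in X_p$, $p\in C$, such that $$\dim\bigl(W^j\cap F_p^{\,n+i-j}\bigr)=i\qquad\text{for all } 0\le i\le j\le n .$$ Call a basis $e_1,\dots,e_n$ of $E_p$ adapted if $F^r_p=\langle e_{n+1-r},\dots,e_n\rangle$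 for all $0\le r\le n$. Then: 1. For every $p\in C$ there are adapted bases of $E_p$, and for every adapted basis the induced isomorphism $X_p=Fl(E_p)\cong Fl(\mathbb C^n)$ maps $X_0\cap X_p$ onto the big cell of $Fl(\mathbb C^n)$, that is, onto the orbit of the standard flag $\langle e_1\rangle\subset\langle e_1,e_2\rangle\subset\dots\subset\mathbb C^n$ under the group of lower triangular unipotent matrices in $SL_n(\mathbb C)$. 2. $\pi|_{X_0}:X_0\to C$ is a holomorphic affine bundle of rank $n(n-1)/2$: $C$ is covered by open sets $U$ for which there are biholomorphic maps $X_0\cap\pi^{-1}(U)\to U\times\mathbb C^{n(n-1)/2}$ compatible with the projections to $U$, where $X_0\cap\pi^{-1}(U)$ is open in $X$, and any two of these trivializations differ, over each point of the overlap of their domains, by an affine automorphism of $\mathbb C^{n(n-1)/2}$. -/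

import Mathlib

open Set Filter Topology Bundle Module
open scoped Manifold ContDiff

set_option linter.unusedSectionVars false

noncomputable section

namespace RelFlag

theorem contDiffAt_iff_an (f : ℂ → ℂ) (z : ℂ) : ContMDiffAt 𝓘(ℂ) 𝓘(ℂ) ω f z ↔ AnalyticAt ℂ f z := by
  rw [contMDiffAt_iff_contDiffAt]
  constructor
  · intro h
    have := contDiffWithinAt_omega_iff_analyticWithinAt.1 (contDiffWithinAt_univ.2 h)
    simpa using this
  · intro h; exact h.contDiffAt

theorem analyticAt_coord {C : Type*} [TopologicalSpace C] [ChartedSpace ℂ C]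
    [IsManifold 𝓘(ℂ) ω C] {p₀ p₁ p : C} (h0 : p ∈ (chartAt ℂ p₀).source) (h1 : p ∈ (chartAt ℂ p₁).source) :
    AnalyticAt ℂ (fun w ↦ chartAt ℂ p₀ ((chartAt ℂ p₁).symm w)) (chartAt ℂ p₁ p) := by
  have h2 : ContMDiffAt 𝓘(ℂ) 𝓘(ℂ) ω (chartAt ℂ p₀) p :=
    contMDiffAt_of_mem_maximalAtlas (IsManifold.chart_mem_maximalAtlas _) h0
  have h3 : ContMDiffAt 𝓘(ℂ) 𝓘(ℂ) ω (chartAt ℂ p₁).symm (chartAt ℂ p₁ p) :=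
    contMDiffAt_symm_of_mem_maximalAtlas (IsManifold.chart_mem_maximalAtlas _)
      ((chartAt ℂ p₁).map_source h1)
  exact (contDiffAt_iff_an _ _).1 (ContMDiffAt.comp_of_eq h2 h3 ((chartAt ℂ p₁).left_inv h1))

section Jets

variable {C : Type*} [TopologicalSpace C] [ChartedSpace ℂ C]
  (L : C → Type*) [∀ x, AddCommGroup (L x)] [∀ x, Module ℂ (L x)] [∀ x, TopologicalSpace (L x)]
  [TopologicalSpace (TotalSpace ℂ L)] [FiberBundle ℂ L] [VectorBundle ℂ ℂ L]

/-- The local expression of a section `s` of the line bundle `L` in the preferred trivialization of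
`L` and the preferred coordinate of `C` at `p₀`. -/
def localExpr (p₀ : C) (s : ∀ x, L x) (z : ℂ) : ℂ :=
  (trivializationAt ℂ L p₀).linearMapAt ℂ ((chartAt ℂ p₀).symm z) (s ((chartAt ℂ p₀).symm z))

/-- Common domain of the preferred coordinate and the preferred trivialization at `p₀`. -/
def jetDomain (p₀ : C) : Set C :=
  (chartAt ℂ p₀).source ∩ (trivializationAt ℂ L p₀).baseSet

theorem isOpen_jetDomain (p₀ : C) : IsOpen (jetDomain L p₀) :=
  (chartAt ℂ p₀).open_source.inter (trivializationAt ℂ L p₀).open_baseSet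

theorem mem_jetDomain (p₀ : C) : p₀ ∈ jetDomain L p₀ :=
  ⟨mem_chart_source ℂ p₀, mem_baseSet_trivializationAt ℂ L p₀⟩

theorem localExpr_add (p₀ : C) (s t : ∀ x, L x) :
    localExpr L p₀ (s + t) = localExpr L p₀ s + localExpr L p₀ t := by
  funext z; simp [localExpr]

theorem localExpr_smul (p₀ : C) (c : ℂ) (s : ∀ x, L x) :
    localExpr L p₀ (c • s) = c • localExpr L p₀ s := by
  funext z; simp [localExpr]

theorem localExpr_zero (p₀ : C) : localExpr L p₀ 0 = 0 := by
  funext z; simp [localExpr]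

theorem eventually_jetDomain (p₀ p : C) (hp : p ∈ jetDomain L p₀) :
    ∀ᶠ z in 𝓝 (chartAt ℂ p₀ p), z ∈ (chartAt ℂ p₀).target ∧
      (chartAt ℂ p₀).symm z ∈ jetDomain L p₀ := by
  have h1 := (chartAt ℂ p₀).open_target.mem_nhds ((chartAt ℂ p₀).map_source hp.1)
  have h2 := (chartAt ℂ p₀).tendsto_symm hp.1
  exact (Filter.Eventually.and h1 (h2 ((isOpen_jetDomain L p₀).mem_nhds hp)))

variable [IsManifold 𝓘(ℂ) ω C] [ContMDiffVectorBundle ω ℂ L 𝓘(ℂ)]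

/-- The sections of `L` (defined everywhere) which are holomorphic near `p`. -/
def holomorphicAt (p : C) : Submodule ℂ (∀ x, L x) where
  carrier := {s | ContMDiffAt 𝓘(ℂ) (𝓘(ℂ).prod 𝓘(ℂ)) ω (fun x ↦ TotalSpace.mk' ℂ x (s x)) p}
  add_mem' hs ht := ContMDiffAt.add_section hs ht
  zero_mem' := contMDiffAt_zeroSection _ _
  smul_mem' _ _ hs := ContMDiffAt.const_smul_section hs

theorem analyticAt_localExpr {p₀ p : C} (hp : p ∈ jetDomain L p₀) {s : ∀ x, L x}
    (hs : s ∈ holomorphicAt L p) : AnalyticAt ℂ (localExpr L p₀ s) (chartAt ℂ p₀ p) := by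
  have h1 := ((trivializationAt ℂ L p₀).contMDiffAt_section_iff (n := ω) (IB := 𝓘(ℂ)) hp.2).1 hs
  have h2 : ContMDiffAt 𝓘(ℂ) 𝓘(ℂ) ω (chartAt ℂ p₀).symm (chartAt ℂ p₀ p) :=
    contMDiffAt_symm_of_mem_maximalAtlas (IsManifold.chart_mem_maximalAtlas _)
      ((chartAt ℂ p₀).map_source hp.1)
  have h3 := (contDiffAt_iff_an _ _).1 (ContMDiffAt.comp_of_eq h1 h2 ((chartAt ℂ p₀).left_inv hp.1))
  refine h3.congr ?_
  filter_upwards [eventually_jetDomain L p₀ p hp] with z hz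
  simp [localExpr, Trivialization.linearMapAt_apply, hz.2.2]

theorem mem_holomorphicAt_of {p₀ p : C} (hp : p ∈ jetDomain L p₀) {s : ∀ x, L x}
    {f : ℂ → ℂ} (hf : AnalyticAt ℂ f (chartAt ℂ p₀ p))
    (h : ∀ x ∈ jetDomain L p₀, (trivializationAt ℂ L p₀ ⟨x, s x⟩).2 = f (chartAt ℂ p₀ x)) :
    s ∈ holomorphicAt L p := by
  refine ((trivializationAt ℂ L p₀).contMDiffAt_section_iff (n := ω) (IB := 𝓘(ℂ)) hp.2).2 ?_
  have h2 : ContMDiffAt 𝓘(ℂ) 𝓘(ℂ) ω (chartAt ℂ p₀) p :=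
    contMDiffAt_of_mem_maximalAtlas (IsManifold.chart_mem_maximalAtlas _) hp.1
  refine (((contDiffAt_iff_an _ _).2 hf).comp p h2).congr_of_eventuallyEq ?_
  filter_upwards [(isOpen_jetDomain L p₀).mem_nhds hp] with x hx
  simp [h x hx]

/-- The transition function of `L` in the coordinate at `p₁`. -/
def transFun (p₀ p₁ : C) (w : ℂ) : ℂ :=
  (trivializationAt ℂ L p₀).coordChangeL ℂ (trivializationAt ℂ L p₁) ((chartAt ℂ p₁).symm w) 1

theorem analyticAt_transFun {p₀ p₁ p : C} (h0 : p ∈ jetDomain L p₀) (h1 : p ∈ jetDomain L p₁) :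
    AnalyticAt ℂ (transFun L p₀ p₁) (chartAt ℂ p₁ p) := by
  have h3 : ContMDiffAt 𝓘(ℂ) 𝓘(ℂ) ω (chartAt ℂ p₁).symm (chartAt ℂ p₁ p) :=
    contMDiffAt_symm_of_mem_maximalAtlas (IsManifold.chart_mem_maximalAtlas _)
      ((chartAt ℂ p₁).map_source h1.1)
  have := contMDiffAt_coordChangeL (n := ω) (IB := 𝓘(ℂ)) (e := trivializationAt ℂ L p₀)
    (e' := trivializationAt ℂ L p₁) h0.2 h1.2
  have h4 := ContMDiffAt.clm_apply this (contMDiffAt_const (c := (1:ℂ)))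
  exact (contDiffAt_iff_an _ _).1 (ContMDiffAt.comp_of_eq h4 h3 ((chartAt ℂ p₁).left_inv h1.1))

theorem localExpr_change {p₀ p₁ p : C} (h0 : p ∈ jetDomain L p₀) (h1 : p ∈ jetDomain L p₁)
    (s : ∀ x, L x) :
    localExpr L p₁ s =ᶠ[𝓝 (chartAt ℂ p₁ p)] transFun L p₀ p₁ *
      (localExpr L p₀ s ∘ fun w ↦ chartAt ℂ p₀ ((chartAt ℂ p₁).symm w)) := by
  have h2 := (chartAt ℂ p₁).tendsto_symm h1.1
  filter_upwards [eventually_jetDomain L p₁ p h1, h2 ((isOpen_jetDomain L p₀).mem_nhds h0)]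
    with z hz hz0
  have hz0 : (chartAt ℂ p₁).symm z ∈ jetDomain L p₀ := hz0
  simp only [localExpr, transFun, Pi.mul_apply, Function.comp_apply]
  rw [(chartAt ℂ p₀).left_inv hz0.1]
  set q := (chartAt ℂ p₁).symm z
  have := (trivializationAt ℂ L p₀).coordChangeL_apply (R := ℂ) (trivializationAt ℂ L p₁) ⟨hz0.2, hz.2.2⟩
    ((trivializationAt ℂ L p₀).linearMapAt ℂ q (s q))
  rw [Trivialization.symm_linearMapAt _ hz0.2] at this
  rw [Trivialization.linearMapAt_apply, if_pos hz.2.2, ← this]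
  rw [mul_comm, ← smul_eq_mul, ← map_smul, smul_eq_mul, mul_one]

theorem analyticOrderAt_localExpr_le {p₀ p₁ p : C} (h0 : p ∈ jetDomain L p₀) (h1 : p ∈ jetDomain L p₁)
    {s : ∀ x, L x} (hs : s ∈ holomorphicAt L p) :
    analyticOrderAt (localExpr L p₀ s) (chartAt ℂ p₀ p) ≤
      analyticOrderAt (localExpr L p₁ s) (chartAt ℂ p₁ p) := by
  have ha := analyticAt_localExpr L h0 hs
  have hτ := analyticAt_coord h0.1 h1.1
  have e : chartAt ℂ p₀ ((chartAt ℂ p₁).symm (chartAt ℂ p₁ p)) = chartAt ℂ p₀ p := by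
    rw [(chartAt ℂ p₁).left_inv h1.1]
  have ha' : AnalyticAt ℂ (localExpr L p₀ s) (chartAt ℂ p₀ ((chartAt ℂ p₁).symm (chartAt ℂ p₁ p))) := by
    rwa [e]
  rw [analyticOrderAt_congr (localExpr_change L h0 h1 s),
    analyticOrderAt_mul (analyticAt_transFun L h0 h1) (ha'.comp (f := fun w ↦ chartAt ℂ p₀ ((chartAt ℂ p₁).symm w)) hτ),
    ha'.analyticOrderAt_comp (g := fun w ↦ chartAt ℂ p₀ ((chartAt ℂ p₁).symm w)) hτ, e]
  have : 1 ≤ analyticOrderAt (fun w ↦ chartAt ℂ p₀ ((chartAt ℂ p₁).symm w) - chartAt ℂ p₀ p) (chartAt ℂ p₁ p) := by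
    have hs0 := hτ.sub (analyticAt_const (v := chartAt ℂ p₀ p))
    rw [Order.one_le_iff_ne_zero]
    refine (AnalyticAt.analyticOrderAt_ne_zero hs0).2 ?_
    simp only [Pi.sub_apply, e, sub_self]
  calc _ ≤ analyticOrderAt (localExpr L p₀ s) (chartAt ℂ p₀ p) * _ := le_mul_of_one_le_right' this
    _ ≤ _ := le_add_self

theorem analyticOrderAt_localExpr {p₀ p : C} (h0 : p ∈ jetDomain L p₀)
    {s : ∀ x, L x} (hs : s ∈ holomorphicAt L p) :
    analyticOrderAt (localExpr L p₀ s) (chartAt ℂ p₀ p) =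
      analyticOrderAt (localExpr L p s) (chartAt ℂ p p) :=
  le_antisymm (analyticOrderAt_localExpr_le L h0 (mem_jetDomain L p) hs)
    (analyticOrderAt_localExpr_le L (mem_jetDomain L p) h0 hs)

/-- The sections holomorphic near `p` which vanish at `p` to order at least `m`. -/
def vanishing (p : C) (m : ℕ) : Submodule ℂ (holomorphicAt L p) where
  carrier := {s | (m : ℕ∞) ≤ analyticOrderAt (localExpr L p s) (chartAt ℂ p p)}
  add_mem' {s t} hs ht := by
    simp only [mem_ofPred_eq, Submodule.coe_add, localExpr_add] at *
    exact (le_min hs ht).trans le_analyticOrderAt_add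
  zero_mem' := by
    simp only [mem_ofPred_eq, Submodule.coe_zero, localExpr_zero]
    rw [(analyticOrderAt_eq_top (f := (0 : ℂ → ℂ))).2 (Eventually.of_forall fun _ ↦ rfl)]
    exact le_top
  smul_mem' c s hs := by
    simp only [mem_ofPred_eq, Submodule.coe_smul, localExpr_smul] at *
    refine hs.trans ?_
    have := analyticOrderAt_smul (f := fun _ ↦ c) analyticAt_const
      (analyticAt_localExpr L (mem_jetDomain L p) s.2)
    change _ ≤ analyticOrderAt ((fun _ : ℂ ↦ c) • localExpr L p s) (chartAt ℂ p p)
    rw [this]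
    exact le_add_self


theorem mem_vanishing_iff {p₀ p : C} (hp : p ∈ jetDomain L p₀) (m : ℕ) (s : holomorphicAt L p) :
    s ∈ vanishing L p m ↔
      ∀ i < m, iteratedDeriv i (localExpr L p₀ s) (chartAt ℂ p₀ p) = 0 := by
  rw [← natCast_le_analyticOrderAt_iff_iteratedDeriv_eq_zero (analyticAt_localExpr L hp s.2),
    analyticOrderAt_localExpr L hp s.2]
  rfl

/-- The derivatives of order `< n` at `p` of a section, in the coordinate and trivialization
at `p₀`. -/
def derivs (n : ℕ) {p₀ p : C} (hp : p ∈ jetDomain L p₀) :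
    holomorphicAt L p →ₗ[ℂ] (Fin n → ℂ) where
  toFun s k := iteratedDeriv k (localExpr L p₀ s) (chartAt ℂ p₀ p)
  map_add' s t := by
    funext k
    simp only [Submodule.coe_add, localExpr_add, Pi.add_apply]
    exact iteratedDeriv_add (analyticAt_localExpr L hp s.2).contDiffAt
      (analyticAt_localExpr L hp t.2).contDiffAt
  map_smul' c s := by
    funext k
    simp only [Submodule.coe_smul, localExpr_smul, Pi.smul_apply, RingHom.id_apply]
    exact iteratedDeriv_const_smul (analyticAt_localExpr L hp s.2).contDiffAt c

theorem ker_derivs (n : ℕ) {p₀ p : C} (hp : p ∈ jetDomain L p₀) :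
    LinearMap.ker (derivs L n hp) = vanishing L p n := by
  ext s
  rw [mem_vanishing_iff L hp, LinearMap.mem_ker, funext_iff]
  exact ⟨fun h i hi ↦ h ⟨i, hi⟩, fun h i ↦ h i i.2⟩

/-- The polynomial with derivatives `a` at `c`. -/
def taylorPoly {n : ℕ} (a : Fin n → ℂ) (c z : ℂ) : ℂ :=
  ∑ l : Fin n, a l * ((z - c) ^ (l : ℕ) / (l : ℕ).factorial)

theorem iteratedDeriv_mono (k l : ℕ) (c : ℂ) :
    iteratedDeriv k (fun z : ℂ ↦ (z - c) ^ l / (l.factorial : ℂ)) c = if k = l then 1 else 0 := by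
  simp only [div_eq_mul_inv, mul_comm _ ((l.factorial : ℂ)⁻¹)]
  rw [iteratedDeriv_const_mul_field,
    iteratedDeriv_comp_sub_const k (fun z : ℂ ↦ z ^ l) c]
  simp only [sub_self, iteratedDeriv_fun_pow_zero]
  split_ifs with h
  · subst h
    simp [Nat.factorial_ne_zero]
  · simp

theorem analyticAt_taylorPoly {n : ℕ} (a : Fin n → ℂ) (c z : ℂ) :
    AnalyticAt ℂ (taylorPoly a c) z := by
  unfold taylorPoly
  fun_prop

theorem iteratedDeriv_taylorPoly {n : ℕ} (a : Fin n → ℂ) (c : ℂ) (k : Fin n) :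
    iteratedDeriv k (taylorPoly a c) c = a k := by
  unfold taylorPoly
  rw [iteratedDeriv_fun_sum (fun i _ ↦ by fun_prop)]
  rw [Finset.sum_eq_single k]
  · rw [iteratedDeriv_const_mul_field, iteratedDeriv_mono]; simp
  · intro b _ hb
    rw [iteratedDeriv_const_mul_field, iteratedDeriv_mono, if_neg, mul_zero]
    exact fun h ↦ hb (Fin.ext h.symm)
  · simp

/-- The section which is polynomial in the coordinate at `p₀`, with derivatives `a` at `p`. -/
def polySection {n : ℕ} {p₀ p : C} (hp : p ∈ jetDomain L p₀) (a : Fin n → ℂ) :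
    holomorphicAt L p :=
  ⟨fun x ↦ (trivializationAt ℂ L p₀).symm x (taylorPoly a (chartAt ℂ p₀ p) (chartAt ℂ p₀ x)),
    mem_holomorphicAt_of L hp (analyticAt_taylorPoly a _ _) fun x hx ↦ by
      rw [Trivialization.apply_mk_symm _ hx.2]⟩

theorem localExpr_polySection {n : ℕ} {p₀ p : C} (hp : p ∈ jetDomain L p₀) (a : Fin n → ℂ) :
    localExpr L p₀ (polySection L hp a) =ᶠ[𝓝 (chartAt ℂ p₀ p)]
      taylorPoly a (chartAt ℂ p₀ p) := by
  filter_upwards [eventually_jetDomain L p₀ p hp] with z hz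
  simp only [localExpr, polySection]
  rw [Trivialization.linearMapAt_symm _ hz.2.2, (chartAt ℂ p₀).right_inv hz.1]

theorem derivs_polySection {n : ℕ} {p₀ p : C} (hp : p ∈ jetDomain L p₀) (a : Fin n → ℂ) :
    derivs L n hp (polySection L hp a) = a := by
  funext k
  change iteratedDeriv k _ _ = _
  rw [(localExpr_polySection L hp a).iteratedDeriv_eq, iteratedDeriv_taylorPoly]

/-- The fibre at `p` of the bundle `J^{n-1}(L)` of `(n-1)`-jets of holomorphic sections of `L`:
germs of holomorphic sections modulo those which vanish to order at least `n`. -/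
def Jet (n : ℕ) (p : C) : Type _ := holomorphicAt L p ⧸ vanishing L p n

instance (n : ℕ) (p : C) : AddCommGroup (Jet L n p) :=
  inferInstanceAs (AddCommGroup (holomorphicAt L p ⧸ vanishing L p n))

instance (n : ℕ) (p : C) : Module ℂ (Jet L n p) :=
  inferInstanceAs (Module ℂ (holomorphicAt L p ⧸ vanishing L p n))

/-- The jet at `p` of a section which is holomorphic near `p`. -/
def jetAt (n : ℕ) (p : C) : holomorphicAt L p →ₗ[ℂ] Jet L n p := (vanishing L p n).mkQ

/-- The filtration of the jet bundle: `F^r` consists of the jets of the sections which vanish to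
order at least `n - r`. -/
def jetFiltration (n : ℕ) (p : C) (r : ℕ) : Submodule ℂ (Jet L n p) :=
  (vanishing L p (n - r)).map (jetAt L n p)

/-- Coordinates of jets: the derivatives of order `0, …, n - 1` in the coordinate and
trivialization at `p₀`. -/
def jetCoord (n : ℕ) {p₀ p : C} (hp : p ∈ jetDomain L p₀) : Jet L n p ≃ₗ[ℂ] (Fin n → ℂ) :=
  (Submodule.quotEquivOfEq _ _ (ker_derivs L n hp).symm).trans
    ((derivs L n hp).quotKerEquivOfSurjective fun a ↦ ⟨_, derivs_polySection L hp a⟩)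

theorem jetCoord_jetAt (n : ℕ) {p₀ p : C} (hp : p ∈ jetDomain L p₀) (s : holomorphicAt L p) :
    jetCoord L n hp (jetAt L n p s) = derivs L n hp s := rfl

theorem jetCoord_symm (n : ℕ) {p₀ p : C} (hp : p ∈ jetDomain L p₀) (a : Fin n → ℂ) :
    (jetCoord L n hp).symm a = jetAt L n p (polySection L hp a) := by
  rw [LinearEquiv.symm_apply_eq, jetCoord_jetAt, derivs_polySection]

instance (n : ℕ) (p : C) : TopologicalSpace (Jet L n p) :=
  TopologicalSpace.induced (jetCoord L n (mem_jetDomain L p)) inferInstance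

open Classical in
/-- The jet coordinates on the domain of `p₀`, as a local trivialization of the jet bundle. -/
def jetPretrivialization (n : ℕ) (p₀ : C) :
    Pretrivialization (Fin n → ℂ) (π (Fin n → ℂ) (Jet L n)) where
  toFun x := (x.1, if h : x.1 ∈ jetDomain L p₀ then jetCoord L n h x.2 else 0)
  invFun y := ⟨y.1, if h : y.1 ∈ jetDomain L p₀ then (jetCoord L n h).symm y.2 else 0⟩
  source := TotalSpace.proj ⁻¹' jetDomain L p₀
  target := jetDomain L p₀ ×ˢ univ
  map_source' _ h := ⟨h, trivial⟩
  map_target' _ h := h.1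
  left_inv' := by
    rintro ⟨x, v⟩ h
    have h : x ∈ jetDomain L p₀ := h
    simp [h]
  right_inv' := by
    rintro ⟨x, v⟩ h
    have h : x ∈ jetDomain L p₀ := h.1
    simp [h]
  open_target := (isOpen_jetDomain L p₀).prod isOpen_univ
  baseSet := jetDomain L p₀
  open_baseSet := isOpen_jetDomain L p₀
  source_eq := rfl
  target_eq := rfl
  proj_toFun _ _ := rfl

theorem jetPretrivialization_apply (n : ℕ) {p₀ p : C} (hp : p ∈ jetDomain L p₀) (v : Jet L n p) :
    jetPretrivialization L n p₀ ⟨p, v⟩ = (p, jetCoord L n hp v) := by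
  change (p, _) = _
  simp [hp]

open Classical in
theorem jetPretrivialization_symm (n : ℕ) {p₀ p : C} (hp : p ∈ jetDomain L p₀) (a : Fin n → ℂ) :
    (jetPretrivialization L n p₀).symm p a = (jetCoord L n hp).symm a := by
  rw [Pretrivialization.symm_apply (jetPretrivialization L n p₀) hp]
  have : (jetPretrivialization L n p₀).toPartialEquiv.symm (p, a) =
      ⟨p, (jetCoord L n hp).symm a⟩ := by
    change (⟨p, dite _ _ _⟩ : TotalSpace _ _) = _
    rw [dif_pos hp]
  exact cast_eq_iff_heq.2 (by rw [this])

instance (n : ℕ) (p₀ : C) : (jetPretrivialization L n p₀).IsLinear ℂ where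
  linear p hp := by
    have hp : p ∈ jetDomain L p₀ := hp
    constructor <;> intros <;> simp [jetPretrivialization_apply L n hp]

/-- The `(m, l)` entry of the transition matrix of the jet bundle. -/
def jetTransition (n : ℕ) (p₀ p₁ p : C) (m l : Fin n) : ℂ :=
  ∑ j ∈ Finset.range (l + 1), iteratedDeriv m
    (fun w ↦ transFun L p₀ p₁ w * (chartAt ℂ p₀ ((chartAt ℂ p₁).symm w)) ^ j) (chartAt ℂ p₁ p) *
    ((-(chartAt ℂ p₀ p)) ^ (l - j : ℕ) * (l : ℕ).choose j / (l : ℕ).factorial)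

theorem jetTransition_spec (n : ℕ) {p₀ p₁ p : C} (h0 : p ∈ jetDomain L p₀)
    (h1 : p ∈ jetDomain L p₁) (a : Fin n → ℂ) (m : Fin n) :
    jetCoord L n h1 ((jetCoord L n h0).symm a) m = ∑ l, jetTransition L n p₀ p₁ p m l * a l := by
  rw [jetCoord_symm, jetCoord_jetAt]
  change iteratedDeriv m _ _ = _
  have hg := analyticAt_transFun L h0 h1
  have hτ := analyticAt_coord h0.1 h1.1
  have e : chartAt ℂ p₀ ((chartAt ℂ p₁).symm (chartAt ℂ p₁ p)) = chartAt ℂ p₀ p := by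
    rw [(chartAt ℂ p₁).left_inv h1.1]
  have key : localExpr L p₁ (polySection L h0 a) =ᶠ[𝓝 (chartAt ℂ p₁ p)]
      fun w ↦ ∑ l : Fin n, ∑ j ∈ Finset.range (l + 1),
        a l * ((-(chartAt ℂ p₀ p)) ^ (l - j : ℕ) * (l : ℕ).choose j / (l : ℕ).factorial) *
          (transFun L p₀ p₁ w * (chartAt ℂ p₀ ((chartAt ℂ p₁).symm w)) ^ j) := by
    refine (localExpr_change L h0 h1 _).trans ?_
    have ht : Tendsto (fun w ↦ chartAt ℂ p₀ ((chartAt ℂ p₁).symm w)) (𝓝 (chartAt ℂ p₁ p))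
        (𝓝 (chartAt ℂ p₀ p)) := by
      have := hτ.continuousAt.tendsto
      rwa [e] at this
    filter_upwards [ht.eventually (localExpr_polySection L h0 a)] with w hw
    simp only [Pi.mul_apply, Function.comp_apply, hw, taylorPoly, Finset.mul_sum]
    refine Finset.sum_congr rfl fun l _ ↦ ?_
    rw [sub_eq_add_neg, add_pow, Finset.sum_div, Finset.mul_sum, Finset.mul_sum]
    refine Finset.sum_congr rfl fun j _ ↦ ?_
    ring
  rw [key.iteratedDeriv_eq, iteratedDeriv_fun_sum]
  · refine Finset.sum_congr rfl fun l _ ↦ ?_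
    rw [iteratedDeriv_fun_sum, jetTransition, Finset.sum_mul]
    · refine Finset.sum_congr rfl fun j _ ↦ ?_
      rw [iteratedDeriv_const_mul_field]
      ring
    · intro j _
      exact (analyticAt_const.mul (hg.mul (hτ.pow j))).contDiffAt
  · intro l _
    refine AnalyticAt.contDiffAt ?_
    exact Finset.analyticAt_fun_sum _ fun j _ ↦ analyticAt_const.mul (hg.mul (hτ.pow j))

theorem contMDiffOn_jetTransition (n : ℕ) (p₀ p₁ : C) (m l : Fin n) :
    ContMDiffOn 𝓘(ℂ) 𝓘(ℂ) ω (fun p ↦ jetTransition L n p₀ p₁ p m l)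
      (jetDomain L p₀ ∩ jetDomain L p₁) := by
  intro p hp
  refine ContMDiffAt.contMDiffWithinAt ?_
  have h0 : ContMDiffAt 𝓘(ℂ) 𝓘(ℂ) ω (chartAt ℂ p₀) p :=
    contMDiffAt_of_mem_maximalAtlas (IsManifold.chart_mem_maximalAtlas _) hp.1.1
  have h1 : ContMDiffAt 𝓘(ℂ) 𝓘(ℂ) ω (chartAt ℂ p₁) p :=
    contMDiffAt_of_mem_maximalAtlas (IsManifold.chart_mem_maximalAtlas _) hp.2.1
  unfold jetTransition
  refine contMDiffAt_finsetSum fun j _ ↦ ?_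
  have hg := analyticAt_transFun L hp.1 hp.2
  have hτ := analyticAt_coord hp.1.1 hp.2.1
  have h2 := (hg.mul (hτ.pow j)).iterated_deriv m
  rw [← iteratedDeriv_eq_iterate] at h2
  have h2 := (contDiffAt_iff_an _ _).2 h2
  have h3 : AnalyticAt ℂ (fun z : ℂ ↦
    (-z) ^ (l - j : ℕ) * (l : ℕ).choose j / (l : ℕ).factorial) (chartAt ℂ p₀ p) := by fun_prop
  exact (h2.comp p h1).mul (((contDiffAt_iff_an _ _).2 h3).comp p h0)

/-- The transition functions of the jet bundle. -/
def jetTransitionL (n : ℕ) (p₀ p₁ p : C) : (Fin n → ℂ) →L[ℂ] (Fin n → ℂ) :=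
  LinearMap.toContinuousLinearMap (Matrix.toLin' (Matrix.of (jetTransition L n p₀ p₁ p)))

theorem contMDiffOn_jetTransitionL (n : ℕ) (p₀ p₁ : C) :
    ContMDiffOn 𝓘(ℂ) 𝓘(ℂ, (Fin n → ℂ) →L[ℂ] (Fin n → ℂ)) ω (jetTransitionL L n p₀ p₁)
      (jetDomain L p₀ ∩ jetDomain L p₁) := by
  have h1 : ContMDiffOn 𝓘(ℂ) 𝓘(ℂ, Fin n → Fin n → ℂ) ω (jetTransition L n p₀ p₁)
      (jetDomain L p₀ ∩ jetDomain L p₁) := by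
    refine contMDiffOn_pi_space.2 fun m ↦ contMDiffOn_pi_space.2 fun l ↦ ?_
    exact contMDiffOn_jetTransition L n p₀ p₁ m l
  let Φ : (Fin n → Fin n → ℂ) →ₗ[ℂ] ((Fin n → ℂ) →L[ℂ] (Fin n → ℂ)) :=
    (LinearMap.toContinuousLinearMap.toLinearMap ∘ₗ
      (Matrix.toLin' (R := ℂ) (m := Fin n) (n := Fin n)).toLinearMap ∘ₗ
      (Matrix.ofLinearEquiv ℂ).toLinearMap)
  exact (LinearMap.toContinuousLinearMap Φ).contDiff.contMDiff.comp_contMDiffOn h1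

theorem jetTransitionL_spec (n : ℕ) (p₀ p₁ p : C) (hp : p ∈ jetDomain L p₀ ∩ jetDomain L p₁)
    (v : Fin n → ℂ) : jetTransitionL L n p₀ p₁ p v =
      (jetPretrivialization L n p₁ ⟨p, (jetPretrivialization L n p₀).symm p v⟩).2 := by
  rw [jetPretrivialization_symm L n hp.1, jetPretrivialization_apply L n hp.2]
  funext m
  exact (jetTransition_spec L n hp.1 hp.2 v m).symm

/-- The jet coordinates as an atlas of local trivializations. -/
def jetPrebundle (n : ℕ) : VectorPrebundle ℂ (Fin n → ℂ) (Jet L n) where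
  pretrivializationAtlas := range (jetPretrivialization L n)
  pretrivialization_linear' := by rintro _ ⟨p, rfl⟩; infer_instance
  pretrivializationAt := jetPretrivialization L n
  mem_base_pretrivializationAt := mem_jetDomain L
  pretrivialization_mem_atlas p := ⟨p, rfl⟩
  exists_coordChange := by
    rintro _ ⟨p₀, rfl⟩ _ ⟨p₁, rfl⟩
    exact ⟨jetTransitionL L n p₀ p₁, (contMDiffOn_jetTransitionL L n p₀ p₁).continuousOn,
      jetTransitionL_spec L n p₀ p₁⟩
  totalSpaceMk_isInducing p := by
    have : jetPretrivialization L n p ∘ TotalSpace.mk p =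
        fun v ↦ (p, jetCoord L n (mem_jetDomain L p) v) := by
      funext v
      exact jetPretrivialization_apply L n (mem_jetDomain L p) v
    rw [this]
    exact isInducing_const_prod.mpr ⟨rfl⟩

instance (n : ℕ) : TopologicalSpace (TotalSpace (Fin n → ℂ) (Jet L n)) :=
  (jetPrebundle L n).totalSpaceTopology

instance (n : ℕ) : FiberBundle (Fin n → ℂ) (Jet L n) := (jetPrebundle L n).toFiberBundle

instance (n : ℕ) : VectorBundle ℂ (Fin n → ℂ) (Jet L n) := (jetPrebundle L n).toVectorBundle

instance (n : ℕ) : (jetPrebundle L n).IsContMDiff 𝓘(ℂ) ω where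
  exists_contMDiffCoordChange := by
    rintro _ ⟨p₀, rfl⟩ _ ⟨p₁, rfl⟩
    exact ⟨jetTransitionL L n p₀ p₁, contMDiffOn_jetTransitionL L n p₀ p₁,
      jetTransitionL_spec L n p₀ p₁⟩

instance (n : ℕ) : ContMDiffVectorBundle ω (Fin n → ℂ) (Jet L n) 𝓘(ℂ) :=
  (jetPrebundle L n).contMDiffVectorBundle 𝓘(ℂ)

end Jets

section Flags

/-- Complete flags `W^0 ⊆ W^1 ⊆ … ⊆ W^n`, `dim W^j = j`, of subspaces of `V`. -/
@[ext]
structure CompleteFlag (n : ℕ) (V : Type*) [AddCommGroup V] [Module ℂ V] where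
  space : Fin (n + 1) → Submodule ℂ V
  mono : Monotone space
  finrank_eq : ∀ j, finrank ℂ (space j) = j

variable {n : ℕ} {V V' V'' : Type*} [AddCommGroup V] [Module ℂ V] [AddCommGroup V'] [Module ℂ V']
  [AddCommGroup V''] [Module ℂ V'']

/-- The image of a flag under a linear isomorphism. -/
def CompleteFlag.map (W : CompleteFlag n V) (e : V ≃ₗ[ℂ] V') : CompleteFlag n V' where
  space j := (W.space j).map (e : V →ₗ[ℂ] V')
  mono _ _ h := Submodule.map_mono (W.mono h)
  finrank_eq j := (LinearEquiv.finrank_map_eq e _).trans (W.finrank_eq j)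

theorem CompleteFlag.map_map (W : CompleteFlag n V) (e : V ≃ₗ[ℂ] V') (e' : V' ≃ₗ[ℂ] V'') :
    (W.map e).map e' = W.map (e.trans e') := by
  ext j x
  simp [CompleteFlag.map]

theorem CompleteFlag.map_refl (W : CompleteFlag n V) : W.map (LinearEquiv.refl ℂ V) = W := by
  ext j x
  simp [CompleteFlag.map]

theorem CompleteFlag.map_map_symm (W : CompleteFlag n V') (e : V ≃ₗ[ℂ] V') :
    (W.map e.symm).map e = W := by
  rw [CompleteFlag.map_map, LinearEquiv.symm_trans_self, CompleteFlag.map_refl]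

theorem CompleteFlag.map_symm_map (W : CompleteFlag n V) (e : V ≃ₗ[ℂ] V') :
    (W.map e).map e.symm = W := by
  rw [CompleteFlag.map_map, LinearEquiv.self_trans_symm, CompleteFlag.map_refl]

theorem finrank_flag (b : Basis (Fin n) ℂ V) (j : Fin (n + 1)) : finrank ℂ (b.flag j) = j := by
  have h := finrank_span_eq_card (R := ℂ) (b := fun i : {i : Fin n // i.castSucc < j} ↦ b i)
    (b.linearIndependent.comp _ Subtype.val_injective)
  have h2 : range (fun i : {i : Fin n // i.castSucc < j} ↦ b i) = b '' {i | i.castSucc < j} := by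
    ext x; simp
  rw [h2] at h
  rw [Basis.flag, h, Fintype.card_subtype]
  have : (Finset.univ.filter fun i : Fin n ↦ i.castSucc < j) =
      Finset.univ.filter fun i : Fin n ↦ (i : ℕ) < j := by
    ext i; simp [Fin.lt_def]
  rw [this, Fin.card_filter_val_lt]
  exact min_eq_right (Nat.lt_succ_iff.1 j.2)

/-- The standard flag of `ℂ^n`: the `j`-th space is spanned by the first `j` basis vectors. -/
def stdFlag (n : ℕ) : CompleteFlag n (Fin n → ℂ) where
  space := (Pi.basisFun ℂ (Fin n)).flag
  mono := (Pi.basisFun ℂ (Fin n)).flag_mono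
  finrank_eq := finrank_flag _

theorem mem_stdFlag (k : Fin (n + 1)) (x : Fin n → ℂ) :
    x ∈ (stdFlag n).space k ↔ ∀ i : Fin n, (k : ℕ) ≤ i → x i = 0 := by
  change x ∈ (Pi.basisFun ℂ (Fin n)).flag k ↔ _
  rw [Basis.flag, Basis.mem_span_image]
  simp only [subset_def, Finset.mem_coe, Finsupp.mem_support_iff, Pi.basisFun_repr, mem_ofPred_eq]
  refine forall_congr' fun i ↦ ?_
  rw [Fin.lt_def, Fin.val_castSucc, not_imp_comm, not_lt]

theorem mem_map_stdFlag (g : (Fin n → ℂ) ≃ₗ[ℂ] V) (k : Fin (n + 1)) (y : V) :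
    y ∈ ((stdFlag n).map g).space k ↔ ∃ x, (∀ i : Fin n, (k : ℕ) ≤ i → x i = 0) ∧ g x = y := by
  simp only [CompleteFlag.map, Submodule.mem_map, mem_stdFlag]
  rfl

/-- `SL_n(ℂ)` acts on the flags of `ℂ^n`. -/
instance : MulAction (Matrix.SpecialLinearGroup (Fin n) ℂ) (CompleteFlag n (Fin n → ℂ)) where
  smul g W := W.map (Matrix.SpecialLinearGroup.toLin' g)
  one_smul W := by
    change W.map (Matrix.SpecialLinearGroup.toLin' 1) = W
    rw [map_one]
    exact W.map_refl
  mul_smul g h W := by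
    change W.map (Matrix.SpecialLinearGroup.toLin' (g * h)) = (W.map _).map _
    rw [map_mul, CompleteFlag.map_map]
    rfl

/-- The subgroup of `SL_n(ℂ)` of the lower triangular matrices with ones on the diagonal. -/
def lowerUnipotent (n : ℕ) : Subgroup (Matrix.SpecialLinearGroup (Fin n) ℂ) where
  carrier := {g | (∀ i j, i < j → g.1 i j = 0) ∧ ∀ i, g.1 i i = 1}
  one_mem' := ⟨fun i j h ↦ Matrix.one_apply_ne h.ne, fun i ↦ Matrix.one_apply_eq i⟩
  mul_mem' {a b} ha hb := by
    have hz : ∀ i j, i ≤ j → ∀ k, k ≠ i ∨ k ≠ j → a.1 i k * b.1 k j = 0 := by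
      intro i j hij k hk
      rcases lt_or_ge i k with h | h
      · rw [ha.1 i k h, zero_mul]
      · rw [hb.1 k j (by grind), mul_zero]
    refine ⟨fun i j h ↦ ?_, fun i ↦ ?_⟩
    · rw [Matrix.SpecialLinearGroup.coe_mul, Matrix.mul_apply]
      exact Finset.sum_eq_zero fun k _ ↦ hz i j h.le k (by grind)
    · rw [Matrix.SpecialLinearGroup.coe_mul, Matrix.mul_apply, Finset.sum_eq_single i]
      · rw [ha.2, hb.2, mul_one]
      · exact fun k _ hk ↦ hz i i le_rfl k (Or.inl hk)
      · simp
  inv_mem' {a} ha := by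
    have hT : Matrix.BlockTriangular a.1 OrderDual.toDual := fun i j h ↦ ha.1 i j h
    have hinv : (a⁻¹).1 = (a.1)⁻¹ := by
      rw [Matrix.SpecialLinearGroup.coe_inv, Matrix.inv_def, a.2, Ring.inverse_one, one_smul]
    have : Invertible a.1 := Matrix.invertibleOfIsUnitDet _ (by rw [a.2]; exact isUnit_one)
    have hT' : Matrix.BlockTriangular (a.1)⁻¹ OrderDual.toDual :=
      Matrix.blockTriangular_inv_of_blockTriangular hT
    rw [← hinv] at hT'
    have h0 : ∀ i j, i < j → (a⁻¹).1 i j = 0 := fun i j h ↦ hT' h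
    refine ⟨h0, fun i ↦ ?_⟩
    have h1 : (a * a⁻¹).1 i i = 1 := by rw [mul_inv_cancel]; exact Matrix.one_apply_eq i
    rw [Matrix.SpecialLinearGroup.coe_mul, Matrix.mul_apply, Finset.sum_eq_single i, ha.2,
      one_mul] at h1
    · exact h1
    · intro k _ hk
      rcases lt_or_ge i k with h | h
      · rw [ha.1 i k h, zero_mul]
      · rw [h0 k i (by grind), mul_zero]
    · simp

/-- The big cell of `Fl(ℂ^n)`: the orbit of the standard flag under the lower unipotent group. -/
def bigCell (n : ℕ) : Set (CompleteFlag n (Fin n → ℂ)) :=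
  MulAction.orbit (lowerUnipotent n) (stdFlag n)

/-- Positions strictly below the diagonal. -/
abbrev LowerIdx (n : ℕ) : Type := {x : Fin n × Fin n // x.2 < x.1}

/-- The lower unipotent matrix with given entries below the diagonal. -/
def lowerMatrix (u : LowerIdx n → ℂ) : Matrix (Fin n) (Fin n) ℂ :=
  Matrix.of fun i j ↦ if h : j < i then u ⟨(i, j), h⟩ else if i = j then 1 else 0

theorem det_lowerMatrix (u : LowerIdx n → ℂ) : (lowerMatrix u).det = 1 := by
  rw [Matrix.det_of_isLowerTriangular]
  · simp [lowerMatrix]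
  · intro i j h
    have h : i < j := h
    simp [lowerMatrix, h.not_gt, h.ne]

/-- The lower unipotent element of `SL_n(ℂ)` with given entries below the diagonal. -/
def lowerSL (u : LowerIdx n → ℂ) : Matrix.SpecialLinearGroup (Fin n) ℂ :=
  ⟨lowerMatrix u, det_lowerMatrix u⟩

/-- The flag given by the lower unipotent matrix with entries `u`. -/
def cellFlag (u : LowerIdx n → ℂ) : CompleteFlag n (Fin n → ℂ) :=
  (stdFlag n).map (Matrix.SpecialLinearGroup.toLin' (lowerSL u))

theorem range_cellFlag : range (cellFlag (n := n)) = bigCell n := by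
  ext W
  constructor
  · rintro ⟨u, rfl⟩
    refine ⟨⟨lowerSL u, fun i j h ↦ ?_, fun i ↦ ?_⟩, rfl⟩
    · simp [lowerSL, lowerMatrix, h.not_gt, h.ne]
    · simp [lowerSL, lowerMatrix]
  · rintro ⟨⟨g, hg⟩, rfl⟩
    refine ⟨fun x ↦ g.1 x.1.1 x.1.2, ?_⟩
    have : lowerSL (fun x : LowerIdx n ↦ g.1 x.1.1 x.1.2) = g := by
      ext i j
      change lowerMatrix (fun x : LowerIdx n ↦ g.1 x.1.1 x.1.2) i j = g.1 i j
      rcases lt_trichotomy i j with h | h | h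
      · simp [lowerMatrix, h.not_gt, h.ne, hg.1 i j h]
      · subst h; simp [lowerMatrix, hg.2 i]
      · simp [lowerMatrix, h]
    rw [cellFlag, this]
    rfl

theorem eq_zero_of_mem_cellFlag (u : LowerIdx n → ℂ) (k : Fin (n + 1)) {y : Fin n → ℂ}
    (hy : y ∈ (cellFlag u).space k) (h0 : ∀ i : Fin n, (i : ℕ) < k → y i = 0) : y = 0 := by
  obtain ⟨x, hx, rfl⟩ := (mem_map_stdFlag _ _ _).1 hy
  suffices x = 0 by rw [this, map_zero]
  have key : ∀ m : ℕ, ∀ i : Fin n, (i : ℕ) = m → x i = 0 := by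
    intro m
    induction m using Nat.strong_induction_on with
    | _ m ih =>
      rintro i rfl
      rcases lt_or_ge (i : ℕ) k with hi | hi
      · have h1 := h0 i hi
        change (lowerMatrix u).mulVec x i = 0 at h1
        rw [Matrix.mulVec, dotProduct, Finset.sum_eq_single i] at h1
        · simpa [lowerMatrix] using h1
        · intro j _ hj
          rcases lt_or_gt_of_ne hj with h | h
          · rw [ih j h j rfl, mul_zero]
          · simp [lowerMatrix, h.not_gt, h.ne]
        · simp
      · exact hx i hi
  exact funext fun i ↦ key i i rfl

theorem lowerMatrix_col_mem (u : LowerIdx n → ℂ) (j : Fin n) :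
    (fun i ↦ lowerMatrix u i j) ∈ (cellFlag u).space j.succ := by
  refine (mem_map_stdFlag _ _ _).2 ⟨Pi.single j 1, fun i hi ↦ ?_, ?_⟩
  · have : j < i := Fin.lt_def.2 (Nat.lt_of_succ_le hi)
    exact Pi.single_eq_of_ne this.ne' _
  · change (lowerMatrix u).mulVec (Pi.single j 1) = _
    rw [Matrix.mulVec_single_one]
    rfl

theorem cellFlag_injective : Function.Injective (cellFlag (n := n)) := by
  intro u v h
  funext ⟨⟨i, j⟩, hij⟩
  have h1 := lowerMatrix_col_mem u j
  rw [h] at h1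
  have h2 := Submodule.sub_mem _ h1 (lowerMatrix_col_mem v j)
  have h3 := eq_zero_of_mem_cellFlag v _ h2 (fun i hi ↦ by
    have hi : i ≤ j := by
      have : (i : ℕ) < j + 1 := by simpa using hi
      exact Fin.le_def.2 (by omega)
    simp [lowerMatrix, hi.not_gt])
  have h4 := congrFun h3 i
  have hij' : j < i := hij
  simpa [lowerMatrix, hij', sub_eq_zero] using h4

/-- The leading block of size `k` of a matrix. -/
def leadBlock (M : Matrix (Fin n) (Fin n) ℂ) {k : ℕ} (hk : k ≤ n) : Matrix (Fin k) (Fin k) ℂ :=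
  M.submatrix (Fin.castLE hk) (Fin.castLE hk)

/-- The combination of the first `j + 1` columns with first `j + 1` entries `0, …, 0, 1`
(by Cramer's rule). -/
def reducedCol (M : Matrix (Fin n) (Fin n) ℂ) (j i : Fin n) : ℂ :=
  ∑ l : Fin (j + 1), M i (Fin.castLE j.2 l) *
    (((leadBlock M (Nat.succ_le_of_lt j.2)).updateCol l (Pi.single (Fin.last j) 1)).det /
      (leadBlock M (Nat.succ_le_of_lt j.2)).det)

/-- The entries of the lower unipotent factor in the factorization of `M`. -/
def lowerCoord (M : Matrix (Fin n) (Fin n) ℂ) (x : LowerIdx n) : ℂ := reducedCol M x.1.2 x.1.1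

theorem sum_castLE {k : ℕ} (hk : k ≤ n) (c : Fin k → ℂ) (f : Fin n → ℂ) :
    ∑ l : Fin n, f l * (if h : (l : ℕ) < k then c ⟨l, h⟩ else 0) =
      ∑ l : Fin k, f (Fin.castLE hk l) * c l := by
  symm
  refine Finset.sum_of_injOn (Fin.castLE hk) (Fin.castLE_injective hk).injOn (by simp) ?_ ?_
  · intro i _ hi
    rw [dif_neg, mul_zero]
    intro h
    exact hi ⟨⟨i, h⟩, by simp, by ext; rfl⟩
  · intro l _
    simp

theorem map_stdFlag_eq_cellFlag (g : (Fin n → ℂ) ≃ₗ[ℂ] (Fin n → ℂ))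
    (h : ∀ (k : ℕ) (hk : k ≤ n), (leadBlock (LinearMap.toMatrix' (g : (Fin n → ℂ) →ₗ[ℂ] _)) hk).det ≠ 0) :
    (stdFlag n).map g = cellFlag (lowerCoord (LinearMap.toMatrix' (g : (Fin n → ℂ) →ₗ[ℂ] _))) := by
  set M := LinearMap.toMatrix' (g : (Fin n → ℂ) →ₗ[ℂ] (Fin n → ℂ)) with hM
  have hg : ∀ x, g x = M.mulVec x := fun x ↦ by
    rw [hM, LinearMap.toMatrix'_mulVec]; rfl
  -- the columns of the unipotent factor lie in the flag
  have hcol : ∀ j : Fin n, reducedCol M j ∈ ((stdFlag n).map g).space j.succ ∧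
      ∀ i : Fin n, i ≤ j → reducedCol M j i = if i = j then 1 else 0 := by
    intro j
    have hk : (j : ℕ) + 1 ≤ n := j.2
    set B := leadBlock M hk with hB
    let c : Fin (j + 1) → ℂ := fun l ↦ (B.updateCol l (Pi.single (Fin.last j) 1)).det / B.det
    have hc : B.mulVec c = Pi.single (Fin.last j) 1 := by
      have h1 := Matrix.mulVec_cramer B (Pi.single (Fin.last (j : ℕ)) 1)
      have h2 : c = B.det⁻¹ • Matrix.cramer B (Pi.single (Fin.last j) 1) := by
        funext l
        simp [c, Matrix.cramer_apply, div_eq_inv_mul]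
      rw [h2, Matrix.mulVec_smul, h1, smul_smul, inv_mul_cancel₀ (h _ hk), one_smul]
    refine ⟨(mem_map_stdFlag _ _ _).2
      ⟨fun l ↦ if hl : (l : ℕ) < j + 1 then c ⟨l, hl⟩ else 0, fun i hi ↦ ?_, ?_⟩, ?_⟩
    · exact dif_neg (not_lt.2 hi)
    · funext i
      rw [hg, Matrix.mulVec, dotProduct, sum_castLE hk]
      rfl
    · intro i hi
      have hi' : (i : ℕ) < j + 1 := Nat.lt_succ_of_le hi
      have h1 := congrFun hc ⟨i, hi'⟩
      have h2 : reducedCol M j i = B.mulVec c ⟨i, hi'⟩ := rfl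
      rw [h2, h1, Pi.single_apply]
      congr 1
      simp [Fin.ext_iff]
  ext1
  funext k
  symm
  refine Submodule.eq_of_le_of_finrank_eq ?_ ?_
  · intro y hy
    obtain ⟨x, hx, rfl⟩ := (mem_map_stdFlag _ _ _).1 hy
    change (lowerMatrix _).mulVec x ∈ _
    rw [Matrix.mulVec_eq_sum]
    refine Submodule.sum_mem _ fun j _ ↦ ?_
    rcases lt_or_ge (j : ℕ) k with hj | hj
    · have hle : j.succ ≤ k := by rw [Fin.le_def]; simpa using hj
      rw [op_smul_eq_smul]
      refine Submodule.smul_mem _ _ (((stdFlag n).map g).mono hle ?_)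
      convert (hcol j).1 using 1
      funext i
      rcases lt_or_ge j i with h | h
      · simp [lowerMatrix, h, lowerCoord]
      · rw [(hcol j).2 i h]
        simp [lowerMatrix, h.not_gt]
    · rw [hx j hj]
      simp
  · rw [CompleteFlag.finrank_eq, CompleteFlag.finrank_eq]

theorem leadBlock_det_ne_zero (g : (Fin n → ℂ) ≃ₗ[ℂ] (Fin n → ℂ))
    (h : (stdFlag n).map g ∈ range (cellFlag (n := n))) (k : ℕ) (hk : k ≤ n) :
    (leadBlock (LinearMap.toMatrix' (g : (Fin n → ℂ) →ₗ[ℂ] _)) hk).det ≠ 0 := by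
  set M := LinearMap.toMatrix' (g : (Fin n → ℂ) →ₗ[ℂ] (Fin n → ℂ)) with hM
  have hg : ∀ x, g x = M.mulVec x := fun x ↦ by
    rw [hM, LinearMap.toMatrix'_mulVec]; rfl
  obtain ⟨u, hu⟩ := h
  intro hdet
  obtain ⟨c, hc0, hc⟩ := Matrix.exists_mulVec_eq_zero_iff.2 hdet
  let x : Fin n → ℂ := fun l ↦ if hl : (l : ℕ) < k then c ⟨l, hl⟩ else 0
  have hy : g x ∈ ((stdFlag n).map g).space ⟨k, Nat.lt_succ_of_le hk⟩ :=
    (mem_map_stdFlag _ _ _).2 ⟨x, fun i hi ↦ dif_neg (not_lt.2 hi), rfl⟩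
  rw [← hu] at hy
  have h0 := eq_zero_of_mem_cellFlag u _ hy (fun i hi ↦ by
    have h1 := congrFun hc ⟨i, hi⟩
    rw [hg, Matrix.mulVec, dotProduct, sum_castLE hk]
    exact h1)
  have hx : x = 0 := by simpa using h0
  refine hc0 (funext fun l ↦ ?_)
  have := congrFun hx (Fin.castLE hk l)
  simpa [x] using this

theorem exists_map_eq_stdFlag (W : CompleteFlag n V) (e : V ≃ₗ[ℂ] (Fin n → ℂ)) :
    ∃ g : V ≃ₗ[ℂ] (Fin n → ℂ), W.map g = stdFlag n := by
  have hfd : FiniteDimensional ℂ V := e.symm.finiteDimensional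
  have hV : finrank ℂ V = n := by simpa using e.finrank_eq
  have hlt : ∀ j : Fin n, ∃ v ∈ W.space j.succ, v ∉ W.space j.castSucc := by
    intro j
    by_contra! hcon
    have h1 := Submodule.finrank_mono (show W.space j.succ ≤ W.space j.castSucc from hcon)
    rw [W.finrank_eq, W.finrank_eq] at h1
    simp at h1
  choose v hv hv' using hlt
  have hle : ∀ k, Submodule.span ℂ (v '' {i | i.castSucc < k}) ≤ W.space k := by
    intro k
    rw [Submodule.span_le]
    rintro _ ⟨i, hi, rfl⟩
    exact W.mono (Fin.castSucc_lt_iff_succ_le.1 hi) (hv i)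
  have hspan : ∀ k : Fin (n + 1), Submodule.span ℂ (v '' {i | i.castSucc < k}) = W.space k := by
    intro k
    induction k using Fin.induction with
    | zero =>
      symm
      have h0 : W.space 0 = ⊥ := Submodule.finrank_eq_zero.1 (by rw [W.finrank_eq]; rfl)
      rw [h0]
      simp
    | succ j ih =>
      refine Submodule.eq_of_le_of_finrank_le (hle _) ?_
      have h1 : W.space j.castSucc < Submodule.span ℂ (v '' {i | i.castSucc < j.succ}) := by
        refine lt_of_le_of_ne ?_ ?_
        · rw [← ih]
          refine Submodule.span_mono (image_mono fun i hi ↦ ?_)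
          exact lt_trans (show i.castSucc < j.castSucc from hi) (Fin.castSucc_lt_succ)
        · intro h
          apply hv' j
          rw [h]
          exact Submodule.subset_span ⟨j, Fin.castSucc_lt_succ, rfl⟩
      have h2 := Submodule.finrank_lt_finrank_of_lt h1
      rw [W.finrank_eq] at h2 ⊢
      simpa using h2
  have htop : ⊤ ≤ Submodule.span ℂ (range v) := by
    have h1 := hspan (Fin.last n)
    have h2 : W.space (Fin.last n) = ⊤ := Submodule.eq_top_of_finrank_eq (by rw [W.finrank_eq, hV]; rfl)
    rw [h2] at h1
    rw [← h1]
    exact Submodule.span_mono (image_subset_range _ _)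
  let b : Basis (Fin n) ℂ V := basisOfTopLeSpanOfCardEqFinrank v htop (by simp [hV])
  have hb : ⇑b = v := coe_basisOfTopLeSpanOfCardEqFinrank _ _ _
  refine ⟨b.equivFun, ?_⟩
  ext1
  funext k
  change (W.space k).map _ = Submodule.span ℂ _
  rw [← hspan k, Submodule.map_span, image_image]
  congr 1
  refine image_congr fun i _ ↦ ?_
  rw [← hb]
  simp [Pi.single_apply, Finsupp.single_apply, funext_iff, eq_comm]

/-- The coordinates of a flag in the big cell: the inverse of `cellFlag`. -/
def cellCoord (W : CompleteFlag n (Fin n → ℂ)) : LowerIdx n → ℂ := Function.invFun cellFlag W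

theorem cellCoord_cellFlag (u : LowerIdx n → ℂ) : cellCoord (cellFlag u) = u :=
  Function.leftInverse_invFun cellFlag_injective u

theorem cellFlag_cellCoord {W : CompleteFlag n (Fin n → ℂ)} (h : W ∈ range (cellFlag (n := n))) :
    cellFlag (cellCoord W) = W := Function.invFun_eq h

end Flags


section Smooth

variable {n : ℕ} {X : Type*} [NormedAddCommGroup X] [NormedSpace ℂ X]

theorem contDiffOn_det {k : ℕ} {s : Set X} {M : X → Matrix (Fin k) (Fin k) ℂ}
    (h : ∀ i j, ContDiffOn ℂ ω (fun x ↦ M x i j) s) : ContDiffOn ℂ ω (fun x ↦ (M x).det) s := by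
  simp only [Matrix.det_apply]
  refine ContDiffOn.sum fun σ _ ↦ ?_
  refine ContDiffOn.const_smul _ (contDiffOn_prod fun i _ ↦ h _ _)

theorem contDiffOn_lowerCoord {s : Set X} {M : X → Matrix (Fin n) (Fin n) ℂ}
    (h : ∀ i j, ContDiffOn ℂ ω (fun x ↦ M x i j) s)
    (hd : ∀ x ∈ s, ∀ (k : ℕ) (hk : k ≤ n), (leadBlock (M x) hk).det ≠ 0) :
    ContDiffOn ℂ ω (fun x ↦ lowerCoord (M x)) s := by
  refine contDiffOn_pi.2 fun a ↦ ?_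
  simp only [lowerCoord, reducedCol]
  refine ContDiffOn.sum fun l _ ↦ (h _ _).mul ?_
  refine ContDiffOn.div (contDiffOn_det fun i j ↦ ?_) (contDiffOn_det fun i j ↦ h _ _)
    fun x hx ↦ hd x hx _ _
  by_cases hj : j = l
  · subst hj
    simp only [Matrix.updateCol_self]
    exact contDiffOn_const
  · simp only [Matrix.updateCol_ne hj]
    exact h _ _

theorem contDiff_lowerMatrix (i j : Fin n) :
    ContDiff ℂ ω (fun u : LowerIdx n → ℂ ↦ lowerMatrix u i j) := by
  unfold lowerMatrix
  simp only [Matrix.of_apply]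
  split_ifs with h h'
  · exact contDiff_apply ℂ ℂ _
  · exact contDiff_const
  · exact contDiff_const

end Smooth

section Bundle

variable {C : Type*} [TopologicalSpace C] (n : ℕ)
  (E : C → Type*) [∀ x, AddCommGroup (E x)] [∀ x, Module ℂ (E x)]

/-- The total space of the relative flag bundle `Fl(E)`: pairs of a point `p` and a complete flag
in the fibre `E_p`. -/
def FlagBundle : Type _ := Σ p, CompleteFlag n (E p)

variable {n E} in
/-- The projection `π : Fl(E) → C`. -/
def FlagBundle.proj (x : FlagBundle n E) : C := x.1

variable [∀ x, TopologicalSpace (E x)] [TopologicalSpace (TotalSpace (Fin n → ℂ) E)]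
  [FiberBundle (Fin n → ℂ) E] [VectorBundle ℂ (Fin n → ℂ) E]

open Classical in
/-- The identification of `E_p` with `ℂ^n` by the preferred trivialization at `p₀` (where this is
not defined, by the preferred trivialization at `p`). -/
def frame (p₀ p : C) : E p ≃ₗ[ℂ] (Fin n → ℂ) :=
  if h : p ∈ (trivializationAt (Fin n → ℂ) E p₀).baseSet then
    (trivializationAt (Fin n → ℂ) E p₀).linearEquivAt ℂ p h
  else (trivializationAt (Fin n → ℂ) E p).linearEquivAt ℂ p (mem_baseSet_trivializationAt _ _ _)

/-- The frame `frame p₀` changed by a constant linear automorphism of `ℂ^n`. -/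
def framing (a : C × ((Fin n → ℂ) ≃ₗ[ℂ] (Fin n → ℂ))) (p : C) : E p ≃ₗ[ℂ] (Fin n → ℂ) :=
  (frame n E a.1 p).trans a.2

variable [ChartedSpace ℂ C]

/-- The domain of the coordinate and of the trivialization at `p₀`, in the coordinate. -/
def coordDomain (p₀ : C) : Set ℂ :=
  (chartAt ℂ p₀).target ∩ (chartAt ℂ p₀).symm ⁻¹' (trivializationAt (Fin n → ℂ) E p₀).baseSet

/-- The charts of `Fl(E)`: a flag over `p`, which in the framing `a` of `E_p` is given by a lower
unipotent matrix, has as coordinates the coordinate of `p` and the entries of the matrix. -/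
def flagChart (a : C × ((Fin n → ℂ) ≃ₗ[ℂ] (Fin n → ℂ))) :
    PartialEquiv (FlagBundle n E) (ℂ × (LowerIdx n → ℂ)) where
  toFun x := (chartAt ℂ a.1 x.1, cellCoord (x.2.map (framing n E a x.1)))
  invFun y := ⟨(chartAt ℂ a.1).symm y.1,
    (cellFlag y.2).map (framing n E a ((chartAt ℂ a.1).symm y.1)).symm⟩
  source := {x | x.1 ∈ (chartAt ℂ a.1).source ∩ (trivializationAt (Fin n → ℂ) E a.1).baseSet ∧
    x.2.map (framing n E a x.1) ∈ range cellFlag}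
  target := coordDomain n E a.1 ×ˢ univ
  map_source' := by
    rintro ⟨p, W⟩ ⟨⟨h1, h2⟩, h3⟩
    exact ⟨⟨(chartAt ℂ a.1).map_source h1, by
      rw [mem_preimage, (chartAt ℂ a.1).left_inv h1]; exact h2⟩, trivial⟩
  map_target' := by
    rintro ⟨z, u⟩ ⟨⟨h1, h2⟩, -⟩
    refine ⟨⟨(chartAt ℂ a.1).map_target h1, h2⟩, u, ?_⟩
    rw [CompleteFlag.map_map_symm]
  left_inv' := by
    rintro ⟨p, W⟩ ⟨⟨h1, h2⟩, h3⟩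
    have key : ∀ q, q = p → (⟨q, (cellFlag (cellCoord (W.map (framing n E a p)))).map
        (framing n E a q).symm⟩ : FlagBundle n E) = ⟨p, W⟩ := by
      rintro q rfl
      rw [cellFlag_cellCoord h3, CompleteFlag.map_symm_map]
    exact key _ ((chartAt ℂ a.1).left_inv h1)
  right_inv' := by
    rintro ⟨z, u⟩ ⟨⟨h1, h2⟩, -⟩
    simp only [CompleteFlag.map_map_symm, cellCoord_cellFlag, (chartAt ℂ a.1).right_inv h1]

theorem exists_mem_flagChart (x : FlagBundle n E) : ∃ g, x ∈ (flagChart n E (x.1, g)).source := by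
  obtain ⟨g, hg⟩ := exists_map_eq_stdFlag x.2 (frame n E x.1 x.1)
  refine ⟨(frame n E x.1 x.1).symm.trans g, ⟨mem_chart_source ℂ x.1,
    mem_baseSet_trivializationAt (Fin n → ℂ) E x.1⟩, ?_⟩
  have h1 : framing n E (x.1, (frame n E x.1 x.1).symm.trans g) x.1 = g := by
    ext v
    simp [framing]
  rw [h1, hg, range_cellFlag]
  exact MulAction.mem_orbit_self _

/-- The transition matrix between two charts. -/
def transMatrix (a b : C × ((Fin n → ℂ) ≃ₗ[ℂ] (Fin n → ℂ))) (y : ℂ × (LowerIdx n → ℂ)) :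
    Matrix (Fin n) (Fin n) ℂ :=
  LinearMap.toMatrix' (((framing n E a ((chartAt ℂ a.1).symm y.1)).symm.trans
    (framing n E b ((chartAt ℂ a.1).symm y.1)) : (Fin n → ℂ) ≃ₗ[ℂ] (Fin n → ℂ)) :
      (Fin n → ℂ) →ₗ[ℂ] (Fin n → ℂ)) * lowerMatrix y.2

/-- The part of the domain of `flagChart a` which lies over the domain of `b`. -/
def overlapBase (a b : C) : Set ℂ :=
  coordDomain n E a ∩ ((chartAt ℂ a).target ∩ (chartAt ℂ a).symm ⁻¹'
    ((chartAt ℂ b).source ∩ (trivializationAt (Fin n → ℂ) E b).baseSet))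

theorem isOpen_overlapBase (a b : C) : IsOpen (overlapBase n E a b) :=
  ((chartAt ℂ a).isOpen_inter_preimage_symm (trivializationAt (Fin n → ℂ) E a).open_baseSet).inter
    ((chartAt ℂ a).isOpen_inter_preimage_symm
      ((chartAt ℂ b).open_source.inter (trivializationAt (Fin n → ℂ) E b).open_baseSet))

theorem flagChart_trans_source (a b : C × ((Fin n → ℂ) ≃ₗ[ℂ] (Fin n → ℂ))) :
    ((flagChart n E a).symm.trans (flagChart n E b)).source =
      {y | y ∈ overlapBase n E a.1 b.1 ×ˢ univ ∧
        ∀ (k : ℕ) (hk : k ≤ n), (leadBlock (transMatrix n E a b y) hk).det ≠ 0} ∧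
    ∀ y ∈ ((flagChart n E a).symm.trans (flagChart n E b)).source,
      ((flagChart n E a).symm.trans (flagChart n E b)) y =
        (chartAt ℂ b.1 ((chartAt ℂ a.1).symm y.1), lowerCoord (transMatrix n E a b y)) := by
  have hM : ∀ y : ℂ × (LowerIdx n → ℂ), ∃ g : (Fin n → ℂ) ≃ₗ[ℂ] (Fin n → ℂ),
      ((cellFlag y.2).map (framing n E a ((chartAt ℂ a.1).symm y.1)).symm).map
        (framing n E b ((chartAt ℂ a.1).symm y.1)) = (stdFlag n).map g ∧
      LinearMap.toMatrix' (g : (Fin n → ℂ) →ₗ[ℂ] (Fin n → ℂ)) = transMatrix n E a b y := by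
    intro y
    refine ⟨(Matrix.SpecialLinearGroup.toLin' (lowerSL y.2)).trans
      ((framing n E a ((chartAt ℂ a.1).symm y.1)).symm.trans
        (framing n E b ((chartAt ℂ a.1).symm y.1))), ?_, ?_⟩
    · rw [cellFlag, CompleteFlag.map_map, CompleteFlag.map_map]
    · rw [transMatrix]
      have : lowerMatrix y.2 = LinearMap.toMatrix' (Matrix.toLin' (lowerMatrix y.2)) := by simp
      rw [this, ← LinearMap.toMatrix'_comp]
      rfl
  have hs : ∀ y, y ∈ ((flagChart n E a).symm.trans (flagChart n E b)).source ↔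
      (y.1 ∈ overlapBase n E a.1 b.1 ∧
      ((cellFlag y.2).map (framing n E a ((chartAt ℂ a.1).symm y.1)).symm).map
        (framing n E b ((chartAt ℂ a.1).symm y.1)) ∈ range cellFlag) := by
    intro y
    rw [PartialEquiv.trans_source]
    constructor
    · rintro ⟨⟨h1, -⟩, h2, h3⟩
      exact ⟨⟨h1, h1.1, h2⟩, h3⟩
    · rintro ⟨⟨h1, -, h2⟩, h3⟩
      exact ⟨⟨h1, trivial⟩, h2, h3⟩
  constructor
  · ext y
    rw [hs y]
    obtain ⟨g, hg, hg'⟩ := hM y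
    rw [hg]
    constructor
    · rintro ⟨h1, h2⟩
      refine ⟨⟨h1, trivial⟩, fun k hk ↦ ?_⟩
      rw [← hg']
      exact leadBlock_det_ne_zero g h2 k hk
    · rintro ⟨⟨h1, -⟩, h2⟩
      refine ⟨h1, _, (map_stdFlag_eq_cellFlag g ?_).symm⟩
      rw [hg']
      exact h2
  · intro y hy
    have h2 := ((hs y).1 hy).2
    obtain ⟨g, hg, hg'⟩ := hM y
    rw [hg] at h2
    refine Prod.ext rfl ?_
    change cellCoord (((cellFlag y.2).map (framing n E a ((chartAt ℂ a.1).symm y.1)).symm).map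
        (framing n E b ((chartAt ℂ a.1).symm y.1))) = lowerCoord (transMatrix n E a b y)
    rw [hg, map_stdFlag_eq_cellFlag g (leadBlock_det_ne_zero g h2), cellCoord_cellFlag, hg']

variable [IsManifold 𝓘(ℂ) ω C] [ContMDiffVectorBundle ω (Fin n → ℂ) E 𝓘(ℂ)]

theorem contDiffOn_transMatrix (a b : C × ((Fin n → ℂ) ≃ₗ[ℂ] (Fin n → ℂ))) (i j : Fin n) :
    ContDiffOn ℂ ω (fun y ↦ transMatrix n E a b y i j) (overlapBase n E a.1 b.1 ×ˢ univ) := by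
  simp only [transMatrix, Matrix.mul_apply]
  refine ContDiffOn.sum fun k _ ↦ ContDiffOn.mul ?_
    ((contDiff_lowerMatrix k j).comp contDiff_snd).contDiffOn
  have h1 : ContMDiffOn 𝓘(ℂ) 𝓘(ℂ, (Fin n → ℂ) →L[ℂ] (Fin n → ℂ)) ω
      (fun z ↦ ((trivializationAt (Fin n → ℂ) E a.1).coordChangeL ℂ
        (trivializationAt (Fin n → ℂ) E b.1) ((chartAt ℂ a.1).symm z) :
          (Fin n → ℂ) →L[ℂ] (Fin n → ℂ))) (overlapBase n E a.1 b.1) := by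
    refine ContMDiffOn.comp (contMDiffOn_coordChangeL (IB := 𝓘(ℂ)) (n := ω) _ _)
      ((contMDiffOn_chart_symm (I := 𝓘(ℂ)) (n := ω) (x := a.1)).mono fun z hz ↦ hz.1.1) ?_
    intro z hz
    exact ⟨hz.1.2, hz.2.2.2⟩
  have h2 := contMDiffOn_iff_contDiffOn.1 h1
  let ℓ : (Fin n → ℂ) →L[ℂ] ℂ := LinearMap.toContinuousLinearMap
    ((LinearMap.proj i : (Fin n → ℂ) →ₗ[ℂ] ℂ) ∘ₗ (b.2 : (Fin n → ℂ) →ₗ[ℂ] (Fin n → ℂ)))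
  have h3 : ContDiffOn ℂ ω (fun z ↦ ℓ (((trivializationAt (Fin n → ℂ) E a.1).coordChangeL ℂ
        (trivializationAt (Fin n → ℂ) E b.1) ((chartAt ℂ a.1).symm z) :
          (Fin n → ℂ) →L[ℂ] (Fin n → ℂ)) (a.2.symm (Pi.single k 1)))) (overlapBase n E a.1 b.1) :=
    ℓ.contDiff.comp_contDiffOn (h2.clm_apply contDiffOn_const)
  refine ((h3.comp contDiff_fst.contDiffOn (fun y hy ↦ hy.1)).congr fun y hy ↦ ?_)
  have hya : (chartAt ℂ a.1).symm y.1 ∈ (trivializationAt (Fin n → ℂ) E a.1).baseSet := hy.1.1.2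
  have hyb : (chartAt ℂ a.1).symm y.1 ∈ (trivializationAt (Fin n → ℂ) E b.1).baseSet :=
    hy.1.2.2.2
  simp only [Function.comp_apply]
  rw [LinearMap.toMatrix'_apply]
  change b.2 (frame n E b.1 _ ((frame n E a.1 _).symm (a.2.symm _))) i = b.2 _ i
  rw [frame, dif_pos hyb, frame, dif_pos hya]
  rw [ContinuousLinearEquiv.coe_coe, Trivialization.coe_coordChangeL _ _ ⟨hya, hyb⟩]
  simp

theorem isOpen_flagChart_trans_source (a b : C × ((Fin n → ℂ) ≃ₗ[ℂ] (Fin n → ℂ))) :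
    IsOpen ((flagChart n E a).symm.trans (flagChart n E b)).source := by
  rw [(flagChart_trans_source n E a b).1]
  have hU : IsOpen (overlapBase n E a.1 b.1 ×ˢ (univ : Set (LowerIdx n → ℂ))) :=
    (isOpen_overlapBase n E a.1 b.1).prod isOpen_univ
  have heq : {y | y ∈ overlapBase n E a.1 b.1 ×ˢ (univ : Set (LowerIdx n → ℂ)) ∧
        ∀ (k : ℕ) (hk : k ≤ n), (leadBlock (transMatrix n E a b y) hk).det ≠ 0} =
      (overlapBase n E a.1 b.1 ×ˢ univ) ∩
        (fun y (k : Fin (n + 1)) ↦ (leadBlock (transMatrix n E a b y) (Nat.lt_succ_iff.1 k.2)).det) ⁻¹'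
          (univ.pi fun _ ↦ {0}ᶜ) := by
    ext y
    simp only [mem_inter_iff, mem_ofPred_eq, mem_preimage, Set.mem_pi, mem_univ, true_imp_iff,
      mem_compl_iff, mem_singleton_iff]
    exact and_congr_right fun _ ↦ ⟨fun h k ↦ h _ _, fun h k hk ↦ h ⟨k, Nat.lt_succ_of_le hk⟩⟩
  rw [heq]
  refine ContinuousOn.isOpen_inter_preimage ?_ hU (isOpen_set_pi finite_univ fun _ _ ↦ isOpen_compl_singleton)
  refine continuousOn_pi.2 fun k ↦ ?_
  exact (contDiffOn_det fun i j ↦ contDiffOn_transMatrix n E a b _ _).continuousOn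

theorem contDiffOn_flagChart_trans (a b : C × ((Fin n → ℂ) ≃ₗ[ℂ] (Fin n → ℂ))) :
    ContDiffOn ℂ ω ((flagChart n E a).symm.trans (flagChart n E b))
      ((flagChart n E a).symm.trans (flagChart n E b)).source := by
  obtain ⟨hs, hf⟩ := flagChart_trans_source n E a b
  refine ContDiffOn.congr ?_ hf
  rw [hs]
  refine ContDiffOn.prodMk ?_ (contDiffOn_lowerCoord
    (fun i j ↦ (contDiffOn_transMatrix n E a b i j).mono fun y hy ↦ hy.1) fun y hy ↦ hy.2)
  have h1 : ContDiffOn ℂ ω (fun z ↦ chartAt ℂ b.1 ((chartAt ℂ a.1).symm z))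
      (overlapBase n E a.1 b.1) := by
    refine contMDiffOn_iff_contDiffOn.1 (ContMDiffOn.comp
      (contMDiffOn_chart (I := 𝓘(ℂ)) (n := ω) (x := b.1))
      ((contMDiffOn_chart_symm (I := 𝓘(ℂ)) (n := ω) (x := a.1)).mono fun z hz ↦ hz.1.1) ?_)
    intro z hz
    exact hz.2.2.1
  exact h1.comp contDiff_fst.contDiffOn fun y hy ↦ hy.1.1

/-- The charts define the topology and the complex structure of `Fl(E)`. -/
def flagChartedSpaceCore : ChartedSpaceCore (ℂ × (LowerIdx n → ℂ)) (FlagBundle n E) where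
  atlas := range (flagChart n E)
  chartAt x := flagChart n E (x.1, Classical.choose (exists_mem_flagChart n E x))
  mem_chart_source x := Classical.choose_spec (exists_mem_flagChart n E x)
  chart_mem_atlas _ := mem_range_self _
  open_source := by
    rintro _ _ ⟨a, rfl⟩ ⟨b, rfl⟩
    exact isOpen_flagChart_trans_source n E a b
  continuousOn_toFun := by
    rintro _ _ ⟨a, rfl⟩ ⟨b, rfl⟩
    exact (contDiffOn_flagChart_trans n E a b).continuousOn

instance : TopologicalSpace (FlagBundle n E) := (flagChartedSpaceCore n E).toTopologicalSpace

instance : ChartedSpace (ℂ × (LowerIdx n → ℂ)) (FlagBundle n E) :=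
  (flagChartedSpaceCore n E).toChartedSpace

/-- `Fl(E)` is a complex manifold. -/
instance : IsManifold 𝓘(ℂ, ℂ × (LowerIdx n → ℂ)) ω (FlagBundle n E) := by
  refine isManifold_of_contDiffOn _ _ _ ?_
  intro e e' he he'
  obtain ⟨f, hf⟩ := mem_iUnion.1 he
  obtain ⟨⟨a, rfl⟩, rfl⟩ := mem_iUnion.1 hf
  obtain ⟨f', hf'⟩ := mem_iUnion.1 he'
  obtain ⟨⟨b, rfl⟩, rfl⟩ := mem_iUnion.1 hf'
  have := contDiffOn_flagChart_trans n E a b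
  rw [modelWithCornersSelf_coe, modelWithCornersSelf_coe_symm, range_id, preimage_id, inter_univ]
  exact this

end Bundle

section Lemma

variable {n : ℕ} {C : Type*}

/-- A basis `e_1, …, e_n` of `V` is adapted to a filtration `F^0 ⊆ … ⊆ F^n` if `F^r` is the span of
the last `r` basis vectors `e_{n+1-r}, …, e_n` (in Lean, the indices run from `0` to `n - 1`). -/
def IsAdapted {V : Type*} [AddCommGroup V] [Module ℂ V] (b : Basis (Fin n) ℂ V)
    (F : ℕ → Submodule ℂ V) : Prop :=
  ∀ r ≤ n, F r = Submodule.span ℂ (b '' {i | n ≤ (i : ℕ) + r})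

/-- The locus in `Fl(E)` of the flags `W` with `dim (W^j ∩ F^{n+i-j}) = i` for all
`0 ≤ i ≤ j ≤ n`, where `F` is a filtration of `E`. -/
def transversalLocus {E : C → Type*} [∀ x, AddCommGroup (E x)] [∀ x, Module ℂ (E x)]
    (F : ∀ p, ℕ → Submodule ℂ (E p)) : Set (FlagBundle n E) :=
  {x | ∀ (i j : ℕ) (hj : j ≤ n), i ≤ j →
    finrank ℂ (x.2.space ⟨j, Nat.lt_succ_of_le hj⟩ ⊓ F x.1 (n + i - j) : Submodule ℂ (E x.1)) = i}

/-- For a map `pr : X → C` from a complex manifold modelled on `M` to a Riemann surface, the restriction of `pr` to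
`S ⊆ X` is a holomorphic affine bundle with fibre the affine space `A`: `C` is covered by open sets
`U` over which `S` is biholomorphic to `U × A`, compatibly with the projections, such that any two
of these trivializations differ on each fibre by an affine automorphism of `A`. (In particular, `S`
is open in `X`, being the union of the sources.) -/
def IsHolomorphicAffineBundle [TopologicalSpace C] [ChartedSpace ℂ C]
    (M : Type*) [NormedAddCommGroup M] [NormedSpace ℂ M]
    {X : Type*} [TopologicalSpace X] [ChartedSpace M X] (pr : X → C) (S : Set X)
    (A : Type*) [NormedAddCommGroup A] [NormedSpace ℂ A] : Prop :=
  ∃ (U : C → Set C) (T : C → OpenPartialHomeomorph X (C × A)),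
    (∀ c, IsOpen (U c) ∧ c ∈ U c ∧
      (T c).source = S ∩ pr ⁻¹' U c ∧ (T c).target = U c ×ˢ univ ∧
      (∀ x ∈ (T c).source, (T c x).1 = pr x) ∧
      ContMDiffOn 𝓘(ℂ, M) (𝓘(ℂ).prod 𝓘(ℂ, A)) ω (T c) (T c).source ∧
      ContMDiffOn (𝓘(ℂ).prod 𝓘(ℂ, A)) 𝓘(ℂ, M) ω (T c).symm (T c).target) ∧
    ∀ c c', ∃ φ : C → (A ≃ᵃ[ℂ] A), ∀ p ∈ U c ∩ U c', ∀ v : A,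
      T c' ((T c).symm (p, v)) = (p, φ p v)

end Lemma

end RelFlag

end

open Bundle Module RelFlag
open scoped Manifold ContDiff

/-!
In the coordinates on `E_p = J^{n-1}(L)_p` given by the derivatives of order `0, …, n - 1`, the step
`F^r` of the filtration is the space `tailSpace n (n - r)` of vectors whose first `n - r` coordinates
vanish (`map_jetCoord_jetFiltration`); in general, a basis is adapted exactly when its coordinates
have this property (`isAdapted_iff`). So both parts are statements about flags of `ℂ^n`.

The dimension conditions which define `X_0` say that a flag is in general position to the flag of
tail spaces, and the flags in general position form the big cell (`mem_range_cellFlag_iff`): if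
`W^{j+1} ∩ tailSpace n (j + 1) = 0`, then a nonzero vector of the line `W^{j+1} ∩ tailSpace n j` can
be scaled to have `j`-th coordinate `1`, and these vectors are the columns of a lower unipotent matrix
which defines `W`. Conversely, for a flag in the big cell the dimensions can be counted, since `W^j`
and `tailSpace n j` are independent.

Over the jet coordinates at `c`, the set `X_0` is therefore the domain of one of the charts which
define the complex structure of `Fl(E)`, and the entries of the unipotent matrix give the
trivialization `flagTriv`. Two systems of jet coordinates differ over `p` by an automorphism `g` of
`ℂ^n` which preserves orders of vanishing, hence the tail spaces, hence is lower triangular. With `D`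
its diagonal part, it maps the flag of a lower unipotent matrix `U` to the flag of the lower unipotent
matrix `g U D⁻¹`, whose entries are affine functions of those of `U` (`cellFlag_map`).
-/

namespace RelFlag

variable {n : ℕ}

/-! ### Flags in general position and the big cell -/

/-- The vectors of `ℂ^n` whose first `m` coordinates vanish: the span of the last `n - m` standard
basis vectors. -/
def tailSpace (n m : ℕ) : Submodule ℂ (Fin n → ℂ) where
  carrier := {y | ∀ i : Fin n, (i : ℕ) < m → y i = 0}
  add_mem' hx hy i hi := by simp [hx i hi, hy i hi]
  zero_mem' _ _ := rfl
  smul_mem' c x hx i hi := by simp [hx i hi]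

theorem mem_tailSpace {m : ℕ} {y : Fin n → ℂ} :
    y ∈ tailSpace n m ↔ ∀ i : Fin n, (i : ℕ) < m → y i = 0 := Iff.rfl

theorem tailSpace_antitone {m m' : ℕ} (h : m ≤ m') : tailSpace n m' ≤ tailSpace n m :=
  fun _ hy i hi ↦ hy i (hi.trans_le h)

theorem finrank_tailSpace {m : ℕ} (hm : m ≤ n) : finrank ℂ (tailSpace n m) = n - m := by
  have hker : LinearMap.ker (LinearMap.funLeft ℂ ℂ (Fin.castLE hm)) = tailSpace n m := by
    ext y
    rw [LinearMap.mem_ker, mem_tailSpace, funext_iff]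
    exact ⟨fun h i hi ↦ h ⟨i, hi⟩, fun h i ↦ h _ i.2⟩
  have h := LinearMap.finrank_range_add_finrank_ker (LinearMap.funLeft ℂ ℂ (Fin.castLE hm))
  rw [hker, LinearMap.range_eq_top.2
    (LinearMap.funLeft_surjective_of_injective ℂ ℂ _ (Fin.castLE_injective hm)), finrank_top,
    finrank_fin_fun, finrank_fin_fun] at h
  omega

theorem tailSpace_eq_span (m : ℕ) :
    tailSpace n m = Submodule.span ℂ (Pi.basisFun ℂ (Fin n) '' {i | m ≤ (i : ℕ)}) := by
  ext y
  rw [Basis.mem_span_image, mem_tailSpace]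
  simp only [subset_def, Finset.mem_coe, Finsupp.mem_support_iff, Pi.basisFun_repr, mem_ofPred_eq]
  exact forall_congr' fun i ↦ by rw [not_imp_comm, not_le]

/-- A flag is determined by vectors in echelon form which it contains. -/
theorem cellFlag_eq_of_col_mem {u : LowerIdx n → ℂ} {W : CompleteFlag n (Fin n → ℂ)}
    (h : ∀ j : Fin n, (fun i ↦ lowerMatrix u i j) ∈ W.space j.succ) : cellFlag u = W := by
  ext1
  funext k
  refine Submodule.eq_of_le_of_finrank_eq (fun y hy ↦ ?_) (by
    rw [CompleteFlag.finrank_eq, CompleteFlag.finrank_eq])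
  obtain ⟨x, hx, rfl⟩ := (mem_map_stdFlag _ _ _).1 hy
  change (lowerMatrix u).mulVec x ∈ _
  rw [Matrix.mulVec_eq_sum]
  refine Submodule.sum_mem _ fun j _ ↦ ?_
  rcases lt_or_ge (j : ℕ) k with hj | hj
  · have hle : j.succ ≤ k := by rw [Fin.le_def]; simpa using hj
    rw [op_smul_eq_smul]
    exact Submodule.smul_mem _ _ (W.mono hle (h j))
  · rw [hx j hj]
    simp

theorem finrank_cellFlag_inf_tailSpace (u : LowerIdx n → ℂ) {i j : ℕ} (hj : j ≤ n) (hij : i ≤ j) :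
    finrank ℂ ((cellFlag u).space ⟨j, Nat.lt_succ_of_le hj⟩ ⊓ tailSpace n (j - i) :
      Submodule ℂ (Fin n → ℂ)) = i := by
  set A := (cellFlag u).space ⟨j, Nat.lt_succ_of_le hj⟩ with hA
  have hAj : finrank ℂ A = j := (cellFlag u).finrank_eq _
  have h1 := Submodule.finrank_sup_add_finrank_inf_eq A (tailSpace n (j - i))
  have h2 := Submodule.finrank_le (A ⊔ tailSpace n (j - i))
  -- `A ⊓ tailSpace n (j - i)` and `tailSpace n j` are independent inside `tailSpace n (j - i)`.
  have h3 := Submodule.finrank_sup_add_finrank_inf_eq (A ⊓ tailSpace n (j - i)) (tailSpace n j)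
  have h4 : A ⊓ tailSpace n (j - i) ⊓ tailSpace n j = ⊥ := by
    rw [eq_bot_iff]
    rintro y ⟨⟨hy, -⟩, hy'⟩
    exact eq_zero_of_mem_cellFlag u _ hy hy'
  have h5 := Submodule.finrank_mono (show A ⊓ tailSpace n (j - i) ⊔ tailSpace n j ≤
    tailSpace n (j - i) from sup_le inf_le_right (tailSpace_antitone (Nat.sub_le j i)))
  rw [h4, finrank_bot] at h3
  rw [finrank_tailSpace (by omega)] at h1 h3 h5
  rw [finrank_fin_fun] at h2
  omega

/-- The big cell consists of the flags in general position to the flag of the spaces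
`tailSpace n m`: a nonzero vector in `W^{j+1} ∩ tailSpace n j` has nonzero `j`-th coordinate, and
so can be scaled to the `j`-th column of a lower unipotent matrix. -/
theorem mem_range_cellFlag_iff (W : CompleteFlag n (Fin n → ℂ)) :
    W ∈ range (cellFlag (n := n)) ↔ ∀ (i j : ℕ) (hj : j ≤ n), i ≤ j →
      finrank ℂ (W.space ⟨j, Nat.lt_succ_of_le hj⟩ ⊓ tailSpace n (j - i) :
        Submodule ℂ (Fin n → ℂ)) = i := by
  refine ⟨?_, fun h ↦ ?_⟩
  · rintro ⟨u, rfl⟩ i j hj hij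
    exact finrank_cellFlag_inf_tailSpace u hj hij
  · have hcol : ∀ j : Fin n, ∃ y ∈ W.space j.succ, y ∈ tailSpace n j ∧ y j = 1 := by
      intro j
      have h1 := h 1 (j + 1) j.2 (by omega)
      have h0 := h 0 (j + 1) j.2 (by omega)
      obtain ⟨y, hy, hy0⟩ := Submodule.exists_mem_ne_zero_of_ne_bot
        (p := W.space j.succ ⊓ tailSpace n j) fun hbot ↦ by
          change finrank ℂ (W.space j.succ ⊓ tailSpace n j : Submodule ℂ (Fin n → ℂ)) = 1 at h1
          rw [hbot, finrank_bot] at h1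
          omega
      rw [Submodule.finrank_eq_zero] at h0
      have hyj : y j ≠ 0 := by
        intro hyj
        refine hy0 ((Submodule.mem_bot ℂ).1 (h0 ▸ ⟨hy.1, fun i hi ↦ ?_⟩))
        rcases Nat.lt_succ_iff_lt_or_eq.1 hi with hi | hi
        · exact hy.2 i hi
        · rwa [Fin.ext hi]
      exact ⟨(y j)⁻¹ • y, Submodule.smul_mem _ _ hy.1, Submodule.smul_mem _ _ hy.2,
        by simp [hyj]⟩
    choose y hyW hyt hy1 using hcol
    refine ⟨fun x ↦ y x.1.2 x.1.1, cellFlag_eq_of_col_mem fun j ↦ ?_⟩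
    convert hyW j using 1
    funext i
    rcases lt_trichotomy i j with hi | rfl | hi
    · simp [lowerMatrix, hi.not_gt, hi.ne, hyt j i hi]
    · simp [lowerMatrix, hy1]
    · simp [lowerMatrix, hi]

/-! ### Lower triangular automorphisms act affinely on the big cell -/

/-- The part below the diagonal of the `j`-th column of a lower unipotent matrix. -/
def lowerCol (j : Fin n) : (LowerIdx n → ℂ) →ₗ[ℂ] (Fin n → ℂ) :=
  LinearMap.pi fun i ↦ if h : j < i then LinearMap.proj ⟨(i, j), h⟩ else 0

theorem lowerCol_mem (j : Fin n) (u : LowerIdx n → ℂ) : lowerCol j u ∈ tailSpace n (j + 1) := by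
  intro i hi
  have hi : ¬ j < i := by rw [Fin.lt_def]; omega
  simp [lowerCol, hi]

theorem lowerMatrix_col (u : LowerIdx n → ℂ) (j : Fin n) :
    (fun i ↦ lowerMatrix u i j) = lowerCol j u + Pi.single j 1 := by
  funext i
  rcases lt_trichotomy i j with h | rfl | h
  · simp [lowerMatrix, lowerCol, h.not_gt, h.ne]
  · simp [lowerMatrix, lowerCol]
  · simp [lowerMatrix, lowerCol, h, h.ne']

/-- The map of the big cell induced by a lower triangular automorphism `g`: if `D` is the diagonal
part of `g` and `U` is lower unipotent, then `g U D⁻¹` is lower unipotent and defines the same flag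
as `g U`; its entries are affine functions of those of `U`. -/
noncomputable def cellAffineMap (g : (Fin n → ℂ) ≃ₗ[ℂ] (Fin n → ℂ)) :
    (LowerIdx n → ℂ) →ᵃ[ℂ] (LowerIdx n → ℂ) :=
  (LinearMap.pi fun x : LowerIdx n ↦ (g (Pi.single x.1.2 1) x.1.2)⁻¹ •
      (LinearMap.proj x.1.1 ∘ₗ (g : (Fin n → ℂ) →ₗ[ℂ] (Fin n → ℂ)) ∘ₗ
        lowerCol x.1.2)).toAffineMap +
    AffineMap.const ℂ _ fun x : LowerIdx n ↦
      (g (Pi.single x.1.2 1) x.1.2)⁻¹ * g (Pi.single x.1.2 1) x.1.1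

theorem cellAffineMap_apply (g : (Fin n → ℂ) ≃ₗ[ℂ] (Fin n → ℂ)) (u : LowerIdx n → ℂ)
    (x : LowerIdx n) : cellAffineMap g u x =
      (g (Pi.single x.1.2 1) x.1.2)⁻¹ * g (lowerCol x.1.2 u + Pi.single x.1.2 1) x.1.1 := by
  simp [cellAffineMap, mul_add]

theorem cellFlag_map (g : (Fin n → ℂ) ≃ₗ[ℂ] (Fin n → ℂ))
    (hg : ∀ m ≤ n, (tailSpace n m).map (g : (Fin n → ℂ) →ₗ[ℂ] (Fin n → ℂ)) = tailSpace n m)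
    (u : LowerIdx n → ℂ) : (cellFlag u).map g = cellFlag (cellAffineMap g u) := by
  have hmem : ∀ m ≤ n, ∀ y ∈ tailSpace n m, g y ∈ tailSpace n m := fun m hm y hy ↦ by
    rw [← hg m hm]; exact Submodule.mem_map_of_mem hy
  symm
  refine cellFlag_eq_of_col_mem fun j ↦ ?_
  have hsingle : (Pi.single j 1 : Fin n → ℂ) ∈ tailSpace n j := fun i hi ↦
    Pi.single_eq_of_ne (Fin.ne_of_lt hi) _
  have hd : g (Pi.single j 1) j ≠ 0 := by
    intro h0
    have h1 : g (Pi.single j 1) ∈ tailSpace n (j + 1) := by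
      intro i hi
      rcases Nat.lt_succ_iff_lt_or_eq.1 hi with hi | hi
      · exact hmem j j.2.le _ hsingle i hi
      · rwa [Fin.ext hi]
    rw [← hg _ j.2] at h1
    obtain ⟨y, hy, hgy⟩ := h1
    have h2 := hy j (Nat.lt_succ_self _)
    rw [g.injective hgy] at h2
    simp at h2
  have hcol : (fun i ↦ lowerMatrix (cellAffineMap g u) i j) =
      (g (Pi.single j 1) j)⁻¹ • g (fun i ↦ lowerMatrix u i j) := by
    rw [lowerMatrix_col u]
    funext i
    have hlow := hmem _ j.2 _ (lowerCol_mem j u)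
    rcases lt_trichotomy i j with h | rfl | h
    · have h1 := hmem j j.2.le _ hsingle i h
      have h2 := hlow i (Nat.lt_succ_of_lt h)
      simp [lowerMatrix, h.not_gt, h.ne, h1, h2]
    · simp [lowerMatrix, hlow i (Nat.lt_succ_self _), hd]
    · simp [lowerMatrix, h, cellAffineMap_apply]
  rw [hcol]
  exact Submodule.smul_mem _ _ (Submodule.mem_map_of_mem (lowerMatrix_col_mem u j))

theorem exists_affineEquiv_cellFlag_map (g : (Fin n → ℂ) ≃ₗ[ℂ] (Fin n → ℂ))
    (hg : ∀ m ≤ n, (tailSpace n m).map (g : (Fin n → ℂ) →ₗ[ℂ] (Fin n → ℂ)) = tailSpace n m) :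
    ∃ φ : (LowerIdx n → ℂ) ≃ᵃ[ℂ] (LowerIdx n → ℂ), ∀ u, (cellFlag u).map g = cellFlag (φ u) := by
  have hg' : ∀ m ≤ n, (tailSpace n m).map (g.symm : (Fin n → ℂ) →ₗ[ℂ] (Fin n → ℂ)) =
      tailSpace n m := fun m hm ↦ by
    conv_lhs => rw [← hg m hm, ← Submodule.map_comp]
    simp
  have hbij : Function.Bijective (cellAffineMap g) := by
    refine Function.bijective_iff_has_inverse.2 ⟨cellAffineMap g.symm, fun u ↦ ?_, fun u ↦ ?_⟩
    · apply cellFlag_injective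
      rw [← cellFlag_map _ hg', ← cellFlag_map _ hg, CompleteFlag.map_symm_map]
    · apply cellFlag_injective
      rw [← cellFlag_map _ hg, ← cellFlag_map _ hg', CompleteFlag.map_map_symm]
  exact ⟨AffineEquiv.ofBijective hbij, fun u ↦ cellFlag_map g hg u⟩

/-! ### Adapted bases and the transversal locus -/

theorem isAdapted_iff {V : Type*} [AddCommGroup V] [Module ℂ V] (b : Basis (Fin n) ℂ V)
    (F : ℕ → Submodule ℂ V) : IsAdapted b F ↔
      ∀ r ≤ n, (F r).map (b.equivFun : V →ₗ[ℂ] (Fin n → ℂ)) = tailSpace n (n - r) := by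
  refine forall₂_congr fun r hr ↦ ?_
  have h : (Submodule.span ℂ (b '' {i | n ≤ (i : ℕ) + r})).map
      (b.equivFun : V →ₗ[ℂ] (Fin n → ℂ)) = tailSpace n (n - r) := by
    rw [tailSpace_eq_span, Submodule.map_span, image_image]
    have hset : {i : Fin n | n ≤ (i : ℕ) + r} = {i : Fin n | n - r ≤ (i : ℕ)} := by
      ext i
      simp only [mem_ofPred_eq]
      omega
    rw [hset]
    congr 1
    refine image_congr fun i _ ↦ ?_
    funext j
    simp [Pi.single_apply, eq_comm]
  rw [← h]
  exact (Submodule.map_injective_of_injective b.equivFun.injective).eq_iff.symm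

theorem mem_transversalLocus_iff {C : Type*} {E : C → Type*} [∀ x, AddCommGroup (E x)]
    [∀ x, Module ℂ (E x)] {F : ∀ p, ℕ → Submodule ℂ (E p)} {p : C} (e : E p ≃ₗ[ℂ] (Fin n → ℂ))
    (he : ∀ r ≤ n, (F p r).map (e : E p →ₗ[ℂ] (Fin n → ℂ)) = tailSpace n (n - r))
    (W : CompleteFlag n (E p)) :
    (⟨p, W⟩ : FlagBundle n E) ∈ transversalLocus F ↔ W.map e ∈ range (cellFlag (n := n)) := by
  rw [mem_range_cellFlag_iff]
  refine forall_congr' fun i ↦ forall_congr' fun j ↦ forall₂_congr fun hj hij ↦ ?_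
  have h1 : n - (n + i - j) = j - i := by omega
  rw [← h1, ← he _ (by omega)]
  change _ ↔ finrank ℂ ((W.space _).map (e : E p →ₗ[ℂ] (Fin n → ℂ)) ⊓ _ : Submodule ℂ _) = i
  rw [← Submodule.map_inf _ e.injective, LinearEquiv.finrank_map_eq]

/-! ### Jet coordinates -/

section Jets

variable {C : Type*} [TopologicalSpace C] [ChartedSpace ℂ C] [IsManifold 𝓘(ℂ) ω C]
  (L : C → Type*) [∀ x, AddCommGroup (L x)] [∀ x, Module ℂ (L x)] [∀ x, TopologicalSpace (L x)]
  [TopologicalSpace (TotalSpace ℂ L)] [FiberBundle ℂ L] [VectorBundle ℂ ℂ L]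
  [ContMDiffVectorBundle ω ℂ L 𝓘(ℂ)]

theorem map_jetCoord_jetFiltration (n : ℕ) {p₀ p : C} (hp : p ∈ jetDomain L p₀) (r : ℕ) :
    (jetFiltration L n p r).map (jetCoord L n hp : Jet L n p →ₗ[ℂ] (Fin n → ℂ)) =
      tailSpace n (n - r) := by
  ext y
  constructor
  · rintro ⟨_, ⟨s, hs, rfl⟩, rfl⟩ i hi
    exact (mem_vanishing_iff L hp _ s).1 hs i hi
  · intro hy
    refine ⟨_, ⟨polySection L hp y, (mem_vanishing_iff L hp _ _).2 fun i hi ↦ ?_, rfl⟩,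
      derivs_polySection L hp y⟩
    exact (congrFun (derivs_polySection L hp y) ⟨i, by omega⟩).trans (hy ⟨i, by omega⟩ hi)

theorem frame_jet (n : ℕ) {p₀ p : C} (hp : p ∈ jetDomain L p₀) :
    frame n (Jet L n) p₀ p = jetCoord L n hp := by
  have hp' : p ∈ (trivializationAt (Fin n → ℂ) (Jet L n) p₀).baseSet := hp
  rw [frame, dif_pos hp']
  ext1 v
  exact congrArg Prod.snd (jetPretrivialization_apply L n hp v)

/-- The transversal locus over the domain of the jet coordinates at `c` is the domain of a chart of
`Fl(E)`; in particular it is open. -/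
theorem flagChart_jet_source (n : ℕ) (c : C) :
    (flagChart n (Jet L n) (c, LinearEquiv.refl ℂ _)).source =
      transversalLocus (jetFiltration L n) ∩ FlagBundle.proj ⁻¹' jetDomain L c := by
  ext ⟨p, W⟩
  have h : ∀ hp : p ∈ jetDomain L c, (⟨p, W⟩ : FlagBundle n (Jet L n)) ∈
      transversalLocus (jetFiltration L n) ↔
        W.map (framing n (Jet L n) (c, LinearEquiv.refl ℂ _) p) ∈ range cellFlag := by
    intro hp
    have : framing n (Jet L n) (c, LinearEquiv.refl ℂ _) p = jetCoord L n hp := by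
      rw [framing, frame_jet L n hp, LinearEquiv.trans_refl]
    rw [this]
    exact mem_transversalLocus_iff _ (fun r _ ↦ map_jetCoord_jetFiltration L n hp r) W
  constructor
  · rintro ⟨⟨-, hp⟩, hW⟩
    exact ⟨(h hp).2 hW, hp⟩
  · rintro ⟨hW, hp⟩
    exact ⟨⟨hp.1, hp⟩, (h hp).1 hW⟩

end Jets

/-! ### Holomorphic trivializations of the big cell bundle -/

section Triv

theorem card_lowerIdx (n : ℕ) : Fintype.card (LowerIdx n) = n * (n - 1) / 2 := by
  have e : LowerIdx n ≃ Σ i : Fin n, Fin i :=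
    { toFun x := ⟨x.1.1, ⟨x.1.2, x.2⟩⟩
      invFun y := ⟨(y.1, ⟨y.2, y.2.2.trans y.1.2⟩), y.2.2⟩
      left_inv _ := rfl
      right_inv _ := rfl }
  rw [Fintype.card_congr e, Fintype.card_sigma, ← Finset.sum_range_id, Finset.sum_range]
  simp

variable {C : Type*} [TopologicalSpace C] [ChartedSpace ℂ C] {n : ℕ}

/-- Listing the positions below the diagonal identifies the coordinate space of the big cell with
`ℂ^{n(n-1)/2}`. -/
noncomputable def lowerReindex (n : ℕ) : (LowerIdx n → ℂ) ≃L[ℂ] (Fin (n * (n - 1) / 2) → ℂ) :=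
  (LinearEquiv.funCongrLeft ℂ ℂ
    (Fintype.equivFinOfCardEq (card_lowerIdx n)).symm).toContinuousLinearEquiv

variable (n) (E : C → Type*) [∀ x, AddCommGroup (E x)] [∀ x, Module ℂ (E x)]
  [∀ x, TopologicalSpace (E x)] [TopologicalSpace (TotalSpace (Fin n → ℂ) E)]
  [FiberBundle (Fin n → ℂ) E] [VectorBundle ℂ (Fin n → ℂ) E]
  [IsManifold 𝓘(ℂ) ω C] [ContMDiffVectorBundle ω (Fin n → ℂ) E 𝓘(ℂ)]

/-- The chart `flagChart` of `Fl(E)` in the trivialization of `E` at `c`, as a homeomorphism between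
open sets. -/
noncomputable def flagHomeo (c : C) :
    OpenPartialHomeomorph (FlagBundle n E) (ℂ × (LowerIdx n → ℂ)) :=
  (flagChartedSpaceCore n E).openPartialHomeomorph (flagChart n E (c, LinearEquiv.refl ℂ _))
    (mem_range_self _)

theorem flagHomeo_mem_maximalAtlas (c : C) : flagHomeo n E c ∈
    IsManifold.maximalAtlas 𝓘(ℂ, ℂ × (LowerIdx n → ℂ)) ω (FlagBundle n E) :=
  IsManifold.subset_maximalAtlas
    (mem_iUnion.2 ⟨_, mem_iUnion.2 ⟨mem_range_self _, rfl⟩⟩)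

/-- The chart `flagHomeo` with its first coordinate, a coordinate on `C`, replaced by the point of
`C`. -/
noncomputable def flagTriv (c : C) :
    OpenPartialHomeomorph (FlagBundle n E) (C × (Fin (n * (n - 1) / 2) → ℂ)) :=
  (flagHomeo n E c).trans
    ((chartAt ℂ c).symm.prod (lowerReindex n).toHomeomorph.toOpenPartialHomeomorph)

theorem flagTriv_source (c : C) :
    (flagTriv n E c).source = (flagChart n E (c, LinearEquiv.refl ℂ _)).source := by
  rw [flagTriv, OpenPartialHomeomorph.trans_source]
  refine inter_eq_left.2 fun x hx ↦ ⟨?_, trivial⟩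
  exact (chartAt ℂ c).map_source hx.1.1

theorem flagTriv_target (c : C) : (flagTriv n E c).target =
    ((chartAt ℂ c).source ∩ (trivializationAt (Fin n → ℂ) E c).baseSet) ×ˢ univ := by
  rw [flagTriv, OpenPartialHomeomorph.trans_target]
  ext ⟨p, v⟩
  constructor
  · rintro ⟨⟨hp, -⟩, ⟨-, h⟩, -⟩
    have h : (chartAt ℂ c).symm (chartAt ℂ c p) ∈ (trivializationAt (Fin n → ℂ) E c).baseSet := h
    rw [(chartAt ℂ c).left_inv hp] at h
    exact ⟨⟨hp, h⟩, trivial⟩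
  · rintro ⟨⟨hp, h⟩, -⟩
    refine ⟨⟨hp, trivial⟩, ⟨(chartAt ℂ c).map_source hp, ?_⟩, trivial⟩
    change (chartAt ℂ c).symm (chartAt ℂ c p) ∈ (trivializationAt (Fin n → ℂ) E c).baseSet
    rwa [(chartAt ℂ c).left_inv hp]

theorem flagTriv_apply {c p : C} (hp : p ∈ (chartAt ℂ c).source) (W : CompleteFlag n (E p)) :
    flagTriv n E c ⟨p, W⟩ = (p, lowerReindex n (cellCoord (W.map (frame n E c p)))) :=
  Prod.ext ((chartAt ℂ c).left_inv hp) rfl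

theorem flagTriv_symm_apply {c p : C} (hp : p ∈ (chartAt ℂ c).source)
    (v : Fin (n * (n - 1) / 2) → ℂ) : (flagTriv n E c).symm (p, v) =
      ⟨p, (cellFlag ((lowerReindex n).symm v)).map (frame n E c p).symm⟩ := by
  -- The base point computed by the chart is only propositionally equal to `p`.
  have key : ∀ q, q = p →
      (⟨q, (cellFlag ((lowerReindex n).symm v)).map
        (framing n E (c, LinearEquiv.refl ℂ _) q).symm⟩ : FlagBundle n E) =
      ⟨p, (cellFlag ((lowerReindex n).symm v)).map (frame n E c p).symm⟩ := by
    rintro q rfl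
    rfl
  exact key _ ((chartAt ℂ c).left_inv hp)

theorem contMDiffOn_flagTriv (c : C) :
    ContMDiffOn 𝓘(ℂ, ℂ × (LowerIdx n → ℂ)) (𝓘(ℂ).prod 𝓘(ℂ, Fin (n * (n - 1) / 2) → ℂ)) ω
      (flagTriv n E c) (flagTriv n E c).source := by
  have h := (contMDiffOn_of_mem_maximalAtlas (flagHomeo_mem_maximalAtlas n E c)).mono
    (fun x (hx : x ∈ (flagTriv n E c).source) ↦ hx.1)
  refine ContMDiffOn.prodMk ?_ ?_
  · refine (contMDiffOn_chart_symm (I := 𝓘(ℂ)) (x := c)).comp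
      (contDiff_fst.contMDiff.comp_contMDiffOn h) fun x hx ↦ hx.2.1
  · exact ((lowerReindex n).contDiff.comp contDiff_snd).contMDiff.comp_contMDiffOn h

theorem contMDiffOn_flagTriv_symm (c : C) :
    ContMDiffOn (𝓘(ℂ).prod 𝓘(ℂ, Fin (n * (n - 1) / 2) → ℂ)) 𝓘(ℂ, ℂ × (LowerIdx n → ℂ)) ω
      (flagTriv n E c).symm (flagTriv n E c).target := by
  refine (contMDiffOn_symm_of_mem_maximalAtlas (flagHomeo_mem_maximalAtlas n E c)).comp
    (t := (flagHomeo n E c).target)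
    (f := fun y : C × (Fin (n * (n - 1) / 2) → ℂ) ↦ (chartAt ℂ c y.1, (lowerReindex n).symm y.2)) ?_
    fun y hy ↦ hy.2
  refine ContMDiffOn.prodMk_space ?_ ?_
  · exact (contMDiffOn_chart (I := 𝓘(ℂ)) (x := c)).comp contMDiff_fst.contMDiffOn
      fun y hy ↦ hy.1.1
  · exact (lowerReindex n).symm.contDiff.contMDiff.comp_contMDiffOn contMDiff_snd.contMDiffOn

end Triv

end RelFlag

theorem mainTheorem1 {C : Type*} [TopologicalSpace C] [ChartedSpace ℂ C] [IsManifold 𝓘(ℂ) ω C]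
    (L : C → Type*) [∀ x, AddCommGroup (L x)] [∀ x, Module ℂ (L x)] [∀ x, TopologicalSpace (L x)]
    [TopologicalSpace (TotalSpace ℂ L)] [FiberBundle ℂ L] [VectorBundle ℂ ℂ L]
    [ContMDiffVectorBundle ω ℂ L 𝓘(ℂ)] (n : ℕ) :
    (∀ p : C,
      (∃ b : Basis (Fin n) ℂ (Jet L n p), IsAdapted b (jetFiltration L n p)) ∧
      ∀ b : Basis (Fin n) ℂ (Jet L n p), IsAdapted b (jetFiltration L n p) →
        (fun W : CompleteFlag n (Jet L n p) ↦ W.map b.equivFun) ''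
            {W | (⟨p, W⟩ : FlagBundle n (Jet L n)) ∈ transversalLocus (jetFiltration L n)} =
          bigCell n) ∧
    IsHolomorphicAffineBundle (ℂ × (LowerIdx n → ℂ)) (FlagBundle.proj (n := n) (E := Jet L n))
      (transversalLocus (jetFiltration L n)) (Fin (n * (n - 1) / 2) → ℂ) := by
  refine ⟨fun p ↦ ⟨⟨Basis.ofEquivFun (jetCoord L n (mem_jetDomain L p)), ?_⟩, fun b hb ↦ ?_⟩,
    jetDomain L, flagTriv n (Jet L n), fun c ↦ ⟨isOpen_jetDomain L c, mem_jetDomain L c,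
      (flagTriv_source n _ c).trans (flagChart_jet_source L n c), ?_, ?_,
      contMDiffOn_flagTriv n _ c, contMDiffOn_flagTriv_symm n _ c⟩, fun c c' ↦ ?_⟩
  · rw [isAdapted_iff, Basis.equivFun_ofEquivFun]
    exact fun r _ ↦ map_jetCoord_jetFiltration L n _ r
  · have h := mem_transversalLocus_iff b.equivFun ((isAdapted_iff b _).1 hb)
    rw [← range_cellFlag]
    ext W
    constructor
    · rintro ⟨W, hW, rfl⟩
      exact (h W).1 hW
    · intro hW
      refine ⟨W.map b.equivFun.symm, (h _).2 ?_, W.map_map_symm _⟩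
      rwa [CompleteFlag.map_map_symm]
  · rw [flagTriv_target]
    congr 1
    exact Set.inter_eq_right.2 fun p hp ↦ hp.1
  · rintro ⟨p, W⟩ hx
    rw [flagTriv_source, flagChart_jet_source] at hx
    exact congrArg Prod.fst (flagTriv_apply n _ hx.2.1 W)
  · have key : ∀ p, ∃ φ : (Fin (n * (n - 1) / 2) → ℂ) ≃ᵃ[ℂ] (Fin (n * (n - 1) / 2) → ℂ),
        p ∈ jetDomain L c ∩ jetDomain L c' → ∀ v,
          flagTriv n (Jet L n) c' ((flagTriv n (Jet L n) c).symm (p, v)) = (p, φ v) := by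
      intro p
      by_cases hp : p ∈ jetDomain L c ∩ jetDomain L c'
      · -- The change of jet coordinates respects the order of vanishing: it is lower triangular.
        obtain ⟨φ, hφ⟩ := exists_affineEquiv_cellFlag_map
          ((jetCoord L n hp.1).symm.trans (jetCoord L n hp.2)) fun m hm ↦ by
            have h1 := map_jetCoord_jetFiltration L n hp.1 (n - m)
            have h2 := map_jetCoord_jetFiltration L n hp.2 (n - m)
            rw [Nat.sub_sub_self hm] at h1 h2
            conv_lhs => rw [← h1, ← Submodule.map_comp]
            rw [← h2]
            congr 1
            ext v : 1
            simp
        let e := (lowerReindex n).toLinearEquiv.toAffineEquiv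
        refine ⟨(e.symm.trans φ).trans e, fun _ v ↦ ?_⟩
        rw [flagTriv_symm_apply n _ hp.1.1, flagTriv_apply n _ hp.2.1, frame_jet L n hp.1,
          frame_jet L n hp.2, CompleteFlag.map_map, hφ, cellCoord_cellFlag]
        rfl
      · exact ⟨AffineEquiv.refl ℂ _, fun h ↦ absurd h hp⟩
    choose φ hφ using key
    exact ⟨φ, hφ⟩
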